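/- Let $h$ be a $C^\infty$ function on an open neighbourhood $U$ of $(0,0)\in\mathbb{R}^2$ whose Taylor expansion at the origin is $$h(u,v)=uv+\tfrac16\left(q_{30}u^3+q_{03}v^3\right)+\sum_{4\le i+j\le 6}\frac{q_{ij}}{i!\,j!}u^iv^j+O(7),\qquad q_{ij}=\frac{\partial^{i+j}h}{\partial u^i\partial v^j}(0,0),$$ and let $X(u,v)=(u,v,h(u,v))$. Write $|a,b,c|$ for the determinant, $L=|X_u,X_v,X_{uu}|$, $M=|X_u,X_v,X_{uv}|$, $N=|X_u,X_v,X_{vv}|$, and, where $LN-M^2\neq0$, let $\nu=|LN-M^2|^{-1/4}X_u\times X_v$ be the conormal and let $\xi$ be the affine (Blaschke) normal, determined by $\langle\nu,\xi\rangle=1$, $\langle\nu,\xi_u\rangle=\langle\nu,\xi_v\rangle=0$. The affine shape operator $B$ is given by $d\xi(w)=B\,w$, the affine principal directions are its real eigenvectors, and the affine curvature lines are the curves tangent to affine principal directions; with $l=\langle\nu_u,\xi_u\rangle$, $m=\langle\nu_u,\xi_v\rangle$, $n=\langle\nu_v,\xi_v\rangle$, their binary differential equation is $$(lM-mL)\,du^2+(lN-nL)\,du\,dv+(mN-nM)\,dv^2=0.\qquad(*)$$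 For a binary differential equation $a\,du^2+b\,du\,dv+c\,dv^2=0$, the discriminant set is $b^2-4ac=0$; for the affine curvature lines it is the set of points where $B$ has a double eigenvalue. An integral curve is the image of an injective $C^\infty$ curve, defined on an open interval, which satisfies the equation (is tangent to principal directions) and whose velocity may vanish only at points of the discriminant set. **Lemma.** Suppose that $q_{31}=0$ and $q_{13}\left(2q_{03}q_{30}^2-7q_{22}q_{30}+2q_{41}\right)\neq0$. Then: 1. $(1,0)$ spans the single affine principal direction at the origin, i.e. $B$ has there a double eigenvalue and is not a multiple of the identity. 2. The configuration of affine curvature lines near $(0,0)$, and likewise the binary differential equation $(*)$ near $(0,0)$, is locally topologically equivalent to the cusp normal form $dv^2+u\,du^2=0$ near $(0,0)$: there is a homeomorphism $H$ between open neighbourhoods of the origin (the first of them contained in $U$ and without parabolic points for the affine curvature lines), $H(0,0)=(0,0)$, such that a subset of the first neighbourhood is an integral curve if and only if its image under $H$ is an integral curve of the normal form, and such that $H$ and $H^{-1}$ preserve the discriminant sets and the singular points (affine umbilics, respectively common zeros of the three coefficients). 3. The solutions have cusps along the discriminant curve: in some neighbourhood of $(0,0)$ there passes an integral curve (of the affine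 curvature lines, and of $(*)$) through every point of the discriminant set, and every integral curve contained in this neighbourhood and passing through a point $x$ of the discriminant set coincides near $x$ with a smooth curve $\gamma$, $\gamma(0)=x$, having an ordinary cusp at $x$: $\gamma'(0)=0$ and $\gamma''(0),\gamma'''(0)$ linearly independent. -/

import Mathlib

open scoped ContDiff Matrix

noncomputable section

namespace AffineLines

/-! ### Line configurations and binary differential equations in the plane -/

/-- A configuration of curves on a plane domain: at each point `x` of `domain`, `dir x w` says that
`w` is tangent to the configuration (`w = 0` is allowed); `disc` is the discriminant set, where the
two tangent directions coincide, and `sing` the set of points at which every direction is tangent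
to the configuration. -/
structure Configuration where
  domain : Set (ℝ × ℝ)
  dir : ℝ × ℝ → ℝ × ℝ → Prop
  disc : Set (ℝ × ℝ)
  sing : Set (ℝ × ℝ)

/-- `Γ` is an (open, unparametrized) integral curve: the image of a smooth injective curve,
everywhere tangent to the configuration, whose velocity may vanish only at discriminant points
(so that a curve with a cusp on the discriminant set is an integral curve). -/
def Configuration.IsCurve (K : Configuration) (Γ : Set (ℝ × ℝ)) : Prop :=
  ∃ (a b : ℝ) (γ : ℝ → ℝ × ℝ), a < b ∧
    ContDiffOn ℝ ∞ γ (Set.Ioo a b) ∧ Set.InjOn γ (Set.Ioo a b) ∧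
    (∀ t ∈ Set.Ioo a b, γ t ∈ K.domain) ∧
    (∀ t ∈ Set.Ioo a b, K.dir (γ t) (deriv γ t)) ∧
    (∀ t ∈ Set.Ioo a b, deriv γ t = 0 → γ t ∈ K.disc) ∧
    γ '' Set.Ioo a b = Γ

/-- Local topological equivalence of two configurations at `p` and `q`: a germ of homeomorphism
`(ℝ², p) → (ℝ², q)` sending the integral curves of the first configuration to those of the second
(and conversely) and preserving the discriminant sets and the singular points. -/
def Configuration.LocallyTopEquiv (K : Configuration) (p : ℝ × ℝ)
    (K' : Configuration) (q : ℝ × ℝ) : Prop :=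
  ∃ H : OpenPartialHomeomorph (ℝ × ℝ) (ℝ × ℝ),
    p ∈ H.source ∧ H p = q ∧ H.source ⊆ K.domain ∧ H.target ⊆ K'.domain ∧
    (∀ Γ ⊆ H.source, K.IsCurve Γ ↔ K'.IsCurve (H '' Γ)) ∧
    (∀ x ∈ H.source, x ∈ K.disc ↔ H x ∈ K'.disc) ∧
    (∀ x ∈ H.source, x ∈ K.sing ↔ H x ∈ K'.sing)

/-- The set `Γ` coincides near `x` with a smooth curve having an ordinary (semicubical) cusp at
`x`: velocity zero, second and third derivatives linearly independent. -/
def HasOrdinaryCuspAt (Γ : Set (ℝ × ℝ)) (x : ℝ × ℝ) : Prop :=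
  ∃ (ε : ℝ) (γ : ℝ → ℝ × ℝ), 0 < ε ∧ ContDiffOn ℝ ∞ γ (Set.Ioo (-ε) ε) ∧
    γ 0 = x ∧ deriv γ 0 = 0 ∧
    LinearIndependent ℝ ![iteratedDeriv 2 γ 0, iteratedDeriv 3 γ 0] ∧
    γ '' Set.Ioo (-ε) ε ⊆ Γ ∧
    ∀ r : ℝ, 0 < r → r ≤ ε → γ '' Set.Ioo (-r) r ∈ nhdsWithin x Γ

/-- Near `p`, an integral curve passes through each discriminant point, and every integral curve
through a discriminant point has an ordinary cusp there. -/
def Configuration.CuspsAlongDiscriminant (K : Configuration) (p : ℝ × ℝ) : Prop :=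
  ∃ V ∈ nhds p, ∀ x ∈ V, x ∈ K.disc →
    (∃ Γ ⊆ V, K.IsCurve Γ ∧ x ∈ Γ) ∧
    ∀ Γ ⊆ V, K.IsCurve Γ → x ∈ Γ → HasOrdinaryCuspAt Γ x

/-- The binary differential equation `a du² + b du dv + c dv² = 0`. -/
structure BDE where
  a : ℝ × ℝ → ℝ
  b : ℝ × ℝ → ℝ
  c : ℝ × ℝ → ℝ

/-- The configuration of the solutions of a binary differential equation on a domain `U`; its
discriminant set is `b² - 4ac = 0`. -/
def BDE.configuration (E : BDE) (U : Set (ℝ × ℝ)) : Configuration where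
  domain := U
  dir x w := E.a x * w.1 ^ 2 + E.b x * w.1 * w.2 + E.c x * w.2 ^ 2 = 0
  disc := {x | x ∈ U ∧ E.b x ^ 2 - 4 * E.a x * E.c x = 0}
  sing := {x | x ∈ U ∧ E.a x = 0 ∧ E.b x = 0 ∧ E.c x = 0}

/-- The normal form `dv² + u du² = 0`. -/
def cuspBDE : BDE where
  a x := x.1
  b _ := 0
  c _ := 1

/-! ### Affine differential geometry of a parametrized surface `X(u, v)` in `ℝ³` -/

/-- Partial derivative with respect to `u`. -/
def pu {E : Type*} [NormedAddCommGroup E] [NormedSpace ℝ E] (f : ℝ × ℝ → E) : ℝ × ℝ → E :=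
  fun x => fderiv ℝ f x (1, 0)

/-- Partial derivative with respect to `v`. -/
def pv {E : Type*} [NormedAddCommGroup E] [NormedSpace ℝ E] (f : ℝ × ℝ → E) : ℝ × ℝ → E :=
  fun x => fderiv ℝ f x (0, 1)

/-- The determinant `|a, b, c|` of three vectors of `ℝ³`. -/
def det3 (a b c : Fin 3 → ℝ) : ℝ := Matrix.det (Matrix.of ![a, b, c])

section Surface

variable (X : ℝ × ℝ → Fin 3 → ℝ)

def coefL (x : ℝ × ℝ) : ℝ := det3 (pu X x) (pv X x) (pu (pu X) x)

def coefM (x : ℝ × ℝ) : ℝ := det3 (pu X x) (pv X x) (pv (pu X) x)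

def coefN (x : ℝ × ℝ) : ℝ := det3 (pu X x) (pv X x) (pv (pv X) x)

/-- `LN - M²`; it vanishes exactly at the parabolic points of a regular surface. -/
def hessDet (x : ℝ × ℝ) : ℝ := coefL X x * coefN X x - coefM X x ^ 2

/-- The conormal vector `ν = |LN - M²|^(-1/4) X_u × X_v`. -/
def conormal (x : ℝ × ℝ) : Fin 3 → ℝ :=
  (|hessDet X x| ^ (1 / 4 : ℝ))⁻¹ • ((pu X x) ⨯₃ (pv X x))

/-- The affine (Blaschke) normal `ξ`: the vector with `⟨ν, ξ⟩ = 1` and `⟨ν_u, ξ⟩ = ⟨ν_v, ξ⟩ = 0`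
(equivalently `⟨ν, ξ⟩ = 1` and `⟨ν, ξ_u⟩ = ⟨ν, ξ_v⟩ = 0`), given by Cramer's rule. Here
`|ν, ν_u, ν_v| = ± |LN - M²|^(1/4)`, with the sign of `LN - M²`. -/
def affineNormal (x : ℝ × ℝ) : Fin 3 → ℝ :=
  (det3 (conormal X x) (pu (conormal X) x) (pv (conormal X) x))⁻¹ •
    ((pu (conormal X) x) ⨯₃ (pv (conormal X) x))

/-- `w = (du, dv)` represents a vector `dX(w)` with `dξ(w) = μ dX(w)` for some real `μ`, i.e. `w` is
zero or an affine principal direction (an eigenvector of the affine shape operator `B`,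
`dξ(x) w = B(x) w`). -/
def IsPrincipal (x w : ℝ × ℝ) : Prop :=
  ∃ μ : ℝ, fderiv ℝ (affineNormal X) x w = μ • fderiv ℝ X x w

/-- The line spanned by `w` is the single affine principal direction at `x`: the affine shape
operator has a double eigenvalue at `x`, and is not a multiple of the identity. -/
def IsDoubleDirectionAt (x w : ℝ × ℝ) : Prop :=
  w ≠ 0 ∧ ∀ w' : ℝ × ℝ, IsPrincipal X x w' ↔ ∃ c : ℝ, w' = c • w

/-- The affine shape operator at `x` is a multiple of the identity. -/
def IsUmbilic (x : ℝ × ℝ) : Prop :=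
  ∃ μ : ℝ, ∀ w : ℝ × ℝ, fderiv ℝ (affineNormal X) x w = μ • fderiv ℝ X x w

/-- The configuration of the affine curvature lines (the curves tangent to affine principal
directions) of the surface outside the parabolic set, in the parameter domain. -/
def affineConfiguration (U : Set (ℝ × ℝ)) : Configuration where
  domain := {x | x ∈ U ∧ hessDet X x ≠ 0}
  dir := IsPrincipal X
  disc := {x | x ∈ U ∧ hessDet X x ≠ 0 ∧ ((∃ w, IsDoubleDirectionAt X x w) ∨ IsUmbilic X x)}
  sing := {x | x ∈ U ∧ hessDet X x ≠ 0 ∧ IsUmbilic X x}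

/-- Coefficients of the affine third fundamental form `⟨dξ, dν⟩ = l du² + 2m du dv + n dv²`. -/
def third_l (x : ℝ × ℝ) : ℝ := (pu (conormal X) x) ⬝ᵥ (pu (affineNormal X) x)

def third_m (x : ℝ × ℝ) : ℝ := (pu (conormal X) x) ⬝ᵥ (pv (affineNormal X) x)

def third_n (x : ℝ × ℝ) : ℝ := (pv (conormal X) x) ⬝ᵥ (pv (affineNormal X) x)

/-- The binary differential equation of the affine curvature lines,
`(lM - mL) du² + (lN - nL) du dv + (mN - nM) dv² = 0`. -/
def affineBDE : BDE where
  a x := third_l X x * coefM X x - third_m X x * coefL X x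
  b x := third_l X x * coefN X x - third_n X x * coefL X x
  c x := third_m X x * coefN X x - third_n X x * coefM X x

end Surface

/-- The Monge chart `(u, v) ↦ (u, v, h(u, v))`. -/
def monge (h : ℝ × ℝ → ℝ) : ℝ × ℝ → Fin 3 → ℝ := fun x => ![x.1, x.2, h x]

/-- The Taylor coefficient `q i j = ∂ᵢ₊ⱼ h / ∂uⁱ ∂vʲ (0, 0)`, so that
`h = ∑ q i j uⁱ vʲ / (i! j!) + O(k)`, the sum being over `i + j < k`. -/
def q (h : ℝ × ℝ → ℝ) (i j : ℕ) : ℝ := (pu^[i] (pv^[j] h)) (0, 0)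

/-- The Taylor expansion of `h` at the origin has the form
`h = uv + (q₃₀ u³ + q₀₃ v³) / 6 + (terms of order at least 4)`. -/
def IsHyperbolicNormalForm (h : ℝ × ℝ → ℝ) : Prop :=
  q h 0 0 = 0 ∧ q h 1 0 = 0 ∧ q h 0 1 = 0 ∧
  q h 2 0 = 0 ∧ q h 1 1 = 1 ∧ q h 0 2 = 0 ∧
  q h 2 1 = 0 ∧ q h 1 2 = 0

end AffineLines

end

open scoped ContDiff Matrix

noncomputable section

namespace AffineLines

open Set Filter Topology Function
open scoped NNReal

/-! ### Fibrewise increasing maps of the plane -/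

/-! Put ρ = (h_uv² − h_uu h_vv)^(1/4). Near a hyperbolic point the affine normal of the graph is a
X_u + b X_v + (0, 0, ρ), where the Hessian of h sends (a, b) to −∇ρ. Hence dξ = da X_u + db X_v, and
the principal directions are the zeros of −b_u du² + (a_u − b_v) du dv + a_v dv²; the equation (*)
is this one times a nonvanishing function (`affineBDE_monge`). At the origin the coefficients are
q₃₁/2, 0, −q₁₃/2, and the u-derivative of the first is a quarter of the second factor in the
hypothesis (`normal_jet`, `pu_lineA_zero`). Completing the square gives (dv + f du)² = r du² with f
= r = 0 and r_u ≠ 0 at the origin (`Configuration.isCuspType_of_quadratic`).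

The rest holds for every equation of this type. In the coordinates (r, v), on the double cover r =
t², the equation becomes an ordinary one, dv/dt = G(t, v), with G smooth near the origin and
divisible by t, and with a sign chosen so that G(t, v) + G(−t, v) > 0 for t ≠ 0. A solution folded
by (t, v) ↦ (t², v) has velocity t φ(t) with φ(0), φ'(0) independent: an ordinary cusp
(`CuspChart.linearIndependent_curve`).

Topologically, a point with r > 0 is reached by one solution at time √r and by another at time −√r.
By the sign condition the pair of their values at time 0 is a faithful coordinate system
(`FoldField.isOpenEmbedding_foldMap`); in it the folded solutions are broken lines with corner on
the diagonal, and r = 0 is the diagonal. This picture no longer depends on the equation, so two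
configurations of cusp type are equivalent (`Configuration.IsCuspType.locallyTopEquiv`). That it
describes all smooth integral curves, even across the discriminant, is `CuspChart.exists_parameter`.
-/

theorem isOpenEmbedding_prodMk_snd {f : ℝ → ℝ → ℝ} (hf : Continuous (uncurry f))
    (hm : ∀ x, StrictMono (f x)) : IsOpenEmbedding (fun p : ℝ × ℝ => (p.1, f p.1 p.2)) := by
  have hc : ∀ y, Continuous fun x => f x y := fun y =>
    hf.comp (continuous_id.prodMk continuous_const)
  refine .of_continuous_injective_isOpenMap (continuous_fst.prodMk hf) ?_ ?_
  · rintro ⟨x, y⟩ ⟨x', y'⟩ h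
    simp only [Prod.mk.injEq] at h
    obtain ⟨rfl, h⟩ := h
    rw [(hm x).injective h]
  · refine IsOpenMap.of_nhds_le fun ⟨x, y⟩ => ?_
    intro S hS
    rw [mem_map, Metric.mem_nhds_iff] at hS
    obtain ⟨ε, hε, hS⟩ := hS
    -- The two strict inequalities persist for nearby x', so the intermediate value theorem yields a
    -- preimage of every nearby value within ε/2 of y. This gives openness without invariance of
    -- domain.
    have h1 : f x (y - ε / 2) < f x y := hm x (by linarith)
    have h2 : f x y < f x (y + ε / 2) := hm x (by linarith)
    have e1 : ∀ᶠ p : ℝ × ℝ in 𝓝 (x, f x y), f p.1 (y - ε / 2) < p.2 :=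
      (((hc _).comp continuous_fst).continuousAt).eventually_lt continuous_snd.continuousAt h1
    have e2 : ∀ᶠ p : ℝ × ℝ in 𝓝 (x, f x y), p.2 < f p.1 (y + ε / 2) :=
      continuous_snd.continuousAt.eventually_lt (((hc _).comp continuous_fst).continuousAt) h2
    have e3 : ∀ᶠ p : ℝ × ℝ in 𝓝 (x, f x y), dist p.1 x < ε :=
      continuous_fst.continuousAt.eventually (p := fun y => dist y x < ε)
        (Metric.ball_mem_nhds x hε)
    filter_upwards [e1, e2, e3] with ⟨x', z⟩ h1 h2 h3
    have hcy : ContinuousOn (f x') (Icc (y - ε / 2) (y + ε / 2)) :=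
      (hf.comp (continuous_const.prodMk continuous_id)).continuousOn
    obtain ⟨w, hw, rfl⟩ := intermediate_value_Icc (by linarith) hcy ⟨h1.le, h2.le⟩
    refine @hS (x', w) ?_
    rw [Metric.mem_ball, Prod.dist_eq, max_lt_iff]
    refine ⟨h3, ?_⟩
    rw [Real.dist_eq, abs_lt]
    constructor <;> linarith [hw.1, hw.2]

theorem isOpenEmbedding_prodMk_fst {f : ℝ → ℝ → ℝ} (hf : Continuous (uncurry f))
    (hm : ∀ y, StrictMono fun x => f x y) :
    IsOpenEmbedding (fun p : ℝ × ℝ => (f p.1 p.2, p.2)) := by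
  have h := isOpenEmbedding_prodMk_snd (f := fun y x => f x y) (hf.comp continuous_swap) hm
  exact (Homeomorph.prodComm ℝ ℝ).isOpenEmbedding.comp
    (h.comp (Homeomorph.prodComm ℝ ℝ).isOpenEmbedding)

theorem isOpenMap_of_strictMono {f : ℝ → ℝ} (hf : Continuous f) (hm : StrictMono f) :
    IsOpenMap f := by
  have h := isOpenEmbedding_prodMk_snd (f := fun _ => f) (hf.comp continuous_snd) fun _ => hm
  intro S hS
  have h2 := (h.isOpenMap (univ ×ˢ S) (isOpen_univ.prod hS)).preimage
    (continuous_const.prodMk continuous_id : Continuous fun y : ℝ => ((0 : ℝ), y))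
  convert h2 using 1
  ext y
  simp

/-! ### Scalar equations `y' = G(t, y)` transverse to their time reversal -/

/-- The global bounds make solutions exist for all time, which avoids tracking domains. `bound_mul`
makes a solution leave its value at time 0 only quadratically. By `pos`, a time-reversed solution,
of slope −G(−t, y), crosses a solution always in the same sense. -/
structure FoldField (G : ℝ → ℝ → ℝ) (L : ℝ≥0) (M : ℝ) : Prop where
  continuous : Continuous (uncurry G)
  lipschitz : ∀ t, LipschitzWith L (G t)
  bound : ∀ t y, |G t y| ≤ M
  bound_mul : ∀ t y, |G t y| ≤ M * |t|
  pos : ∀ t, t ≠ 0 → ∀ y, 0 < G t y + G (-t) y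

namespace FoldField

variable {G : ℝ → ℝ → ℝ} {L : ℝ≥0} {M : ℝ}

theorem exists_Icc (hG : FoldField G L M) (t₀ s : ℝ) {T : ℝ} (hT : 0 < T) :
    ∃ y : ℝ → ℝ, y t₀ = s ∧
      ∀ t ∈ Icc (t₀ - T) (t₀ + T), HasDerivWithinAt y (G t (y t)) (Icc (t₀ - T) (t₀ + T)) t := by
  have hM : 0 ≤ M := (abs_nonneg _).trans (hG.bound 0 0)
  -- Speed at most M keeps the solution within M T of s, so the radius M T works for arbitrarily
  -- long intervals.
  have hP : IsPicardLindelof G (tmin := t₀ - T) (tmax := t₀ + T)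
      ⟨t₀, by constructor <;> linarith⟩ s ⟨M * T, by positivity⟩ 0 ⟨M, hM⟩ L :=
    { lipschitzOnWith := fun t _ => (hG.lipschitz t).lipschitzOnWith
      continuousOn := fun x _ =>
        (hG.continuous.comp (continuous_id.prodMk continuous_const)).continuousOn
      norm_le := fun t _ x _ => hG.bound t x
      mul_max_le := by simp; rfl }
  exact hP.exists_eq_forall_mem_Icc_hasDerivWithinAt₀

theorem exists_solution (hG : FoldField G L M) (t₀ s : ℝ) :
    ∃ y : ℝ → ℝ, y t₀ = s ∧ ∀ t, HasDerivAt y (G t (y t)) t := by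
  choose y hy0 hy using fun n : ℕ => hG.exists_Icc t₀ s (T := n + 1) (by positivity)
  have hd : ∀ (n : ℕ) (t : ℝ), t ∈ Ioo (t₀ - (n + 1)) (t₀ + (n + 1)) →
      HasDerivAt (y n) (G t (y n t)) t := fun n t ht =>
    (hy n t (Ioo_subset_Icc_self ht)).hasDerivAt (Icc_mem_nhds ht.1 ht.2)
  have hu : ∀ (n m : ℕ), n ≤ m → EqOn (y n) (y m) (Ioo (t₀ - (n + 1)) (t₀ + (n + 1))) := by
    intro n m hnm
    have hnm' : (n : ℝ) ≤ m := by exact_mod_cast hnm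
    refine ODE_solution_unique_of_mem_Ioo (v := G) (s := fun _ => univ) (t₀ := t₀)
      (fun t _ => (hG.lipschitz t).lipschitzOnWith) ?_ (fun t ht => ⟨hd n t ht, trivial⟩)
      (fun t ht => ⟨hd m t ⟨by linarith [ht.1], by linarith [ht.2]⟩, trivial⟩)
      ((hy0 n).trans (hy0 m).symm)
    constructor <;> linarith [(n.cast_nonneg : (0 : ℝ) ≤ n)]
  -- The patched solution uses the interval of radius N t + 1 at time t. For τ near t one has N τ ≤
  -- N t + 1, so the single solution of index N t + 1 represents it there.
  set N : ℝ → ℕ := fun t => ⌈|t - t₀|⌉₊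
  have hN : ∀ t, t ∈ Ioo (t₀ - ((N t : ℝ) + 1)) (t₀ + ((N t : ℝ) + 1)) := by
    intro t
    have h1 : |t - t₀| ≤ N t := Nat.le_ceil _
    have h2 := abs_le.1 h1
    constructor <;> linarith
  refine ⟨fun t => y (N t) t, hy0 _, fun t => ?_⟩
  have hev : (fun τ => y (N τ) τ) =ᶠ[𝓝 t] y (N t + 1) := by
    have hmem : Ioo (t₀ - ((N t : ℝ) + 1)) (t₀ + ((N t : ℝ) + 1)) ∈ 𝓝 t :=
      Ioo_mem_nhds (hN t).1 (hN t).2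
    filter_upwards [hmem] with τ hτ
    refine hu _ _ ?_ (hN τ)
    refine Nat.ceil_le.2 ?_
    push_cast
    rw [abs_le]
    constructor <;> linarith [hτ.1, hτ.2]
  have hder := hd (N t + 1) t
    ⟨by push_cast; linarith [(hN t).1], by push_cast; linarith [(hN t).2]⟩
  have hval : y (N t) t = y (N t + 1) t := hev.self_of_nhds
  simp only [hval]
  exact hder.congr_of_eventuallyEq hev

/-- The solution with value `s` at time `t₀`, evaluated at time `t`. -/
def sol (hG : FoldField G L M) (t₀ s t : ℝ) : ℝ := (hG.exists_solution t₀ s).choose t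

theorem sol_self (hG : FoldField G L M) (t₀ s : ℝ) : hG.sol t₀ s t₀ = s :=
  (hG.exists_solution t₀ s).choose_spec.1

theorem hasDerivAt_sol (hG : FoldField G L M) (t₀ s t : ℝ) :
    HasDerivAt (hG.sol t₀ s) (G t (hG.sol t₀ s t)) t :=
  (hG.exists_solution t₀ s).choose_spec.2 t

theorem continuous_sol (hG : FoldField G L M) (t₀ s : ℝ) : Continuous (hG.sol t₀ s) :=
  continuous_iff_continuousAt.2 fun t => (hG.hasDerivAt_sol t₀ s t).continuousAt

theorem sol_eq_of_eq (hG : FoldField G L M) {t₀ s t₁ s' t : ℝ}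
    (h : hG.sol t₀ s t = hG.sol t₁ s' t) : hG.sol t₀ s = hG.sol t₁ s' :=
  ODE_solution_unique_univ (v := G) (s := fun _ => univ) (t₀ := t)
    (fun t => (hG.lipschitz t).lipschitzOnWith) (fun t => ⟨hG.hasDerivAt_sol t₀ s t, trivial⟩)
    (fun t => ⟨hG.hasDerivAt_sol t₁ s' t, trivial⟩) h

/-- Value at time `t` of the solution with value `s` at time `0`. -/
def flow (hG : FoldField G L M) (t s : ℝ) : ℝ := hG.sol 0 s t

/-- Value at time `0` of the solution with value `v` at time `t`. -/
def initial (hG : FoldField G L M) (t v : ℝ) : ℝ := hG.sol t v 0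

@[simp] theorem flow_zero (hG : FoldField G L M) (s : ℝ) : hG.flow 0 s = s := hG.sol_self 0 s

theorem hasDerivAt_flow (hG : FoldField G L M) (t s : ℝ) :
    HasDerivAt (fun t => hG.flow t s) (G t (hG.flow t s)) t := hG.hasDerivAt_sol 0 s t

@[simp] theorem flow_initial (hG : FoldField G L M) (t v : ℝ) :
    hG.flow t (hG.initial t v) = v := by
  have h : hG.sol 0 (hG.initial t v) = hG.sol t v :=
    hG.sol_eq_of_eq (t := 0) (hG.sol_self 0 _)
  rw [flow, h, sol_self]

/-- Two solutions that changed order would meet at some time, and then coincide by uniqueness. -/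
theorem flow_strictMono (hG : FoldField G L M) (t : ℝ) : StrictMono (hG.flow t) := by
  intro s₁ s₂ hs
  by_contra! hle
  have hc : Continuous fun τ => hG.flow τ s₂ - hG.flow τ s₁ :=
    (hG.continuous_sol 0 s₂).sub (hG.continuous_sol 0 s₁)
  have h0 : (0 : ℝ) ∈ uIcc (hG.flow 0 s₂ - hG.flow 0 s₁) (hG.flow t s₂ - hG.flow t s₁) := by
    rw [flow_zero, flow_zero]
    exact mem_uIcc_of_ge (by linarith) (by linarith)
  obtain ⟨τ, -, hτ⟩ := intermediate_value_uIcc hc.continuousOn h0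
  have h := hG.sol_eq_of_eq (t := τ) (t₀ := 0) (t₁ := 0) (s := s₂) (s' := s₁) (sub_eq_zero.1 hτ)
  have h' := congrFun h 0
  rw [sol_self, sol_self] at h'
  exact hs.ne' h'

@[simp] theorem initial_flow (hG : FoldField G L M) (t s : ℝ) :
    hG.initial t (hG.flow t s) = s :=
  (hG.flow_strictMono t).injective (hG.flow_initial _ _)

@[simp] theorem initial_zero (hG : FoldField G L M) (s : ℝ) : hG.initial 0 s = s :=
  hG.sol_self 0 s

theorem initial_strictMono (hG : FoldField G L M) (t : ℝ) : StrictMono (hG.initial t) := by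
  intro v₁ v₂ hv
  rwa [← (hG.flow_strictMono t).lt_iff_lt, flow_initial, flow_initial]

/-- At fixed time the flow is an increasing bijection of the line, hence continuous; in time it is
M-Lipschitz uniformly in s. -/
theorem continuous_flow (hG : FoldField G L M) : Continuous (uncurry hG.flow) := by
  have hM : 0 ≤ M := (abs_nonneg _).trans (hG.bound 0 0)
  refine continuous_prod_of_continuous_lipschitzWith _ M.toNNReal (fun t => ?_) (fun s => ?_)
  · exact (hG.flow_strictMono t).monotone.continuous_of_surjective
      fun v => ⟨hG.initial t v, hG.flow_initial t v⟩
  · refine lipschitzWith_of_nnnorm_deriv_le (f := fun t => hG.flow t s)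
      (fun t => (hG.hasDerivAt_flow t s).differentiableAt) fun t => ?_
    rw [(hG.hasDerivAt_flow t s).deriv, ← NNReal.coe_le_coe, coe_nnnorm, Real.coe_toNNReal _ hM]
    exact hG.bound _ _

theorem continuous_initial (hG : FoldField G L M) : Continuous (uncurry hG.initial) := by
  have h := isOpenEmbedding_prodMk_snd hG.continuous_flow hG.flow_strictMono
  have h2 : Continuous fun p : ℝ × ℝ => (p.1, hG.initial p.1 p.2) := by
    rw [h.toIsInducing.continuous_iff]
    convert continuous_id using 1
    ext p <;> simp
  exact continuous_snd.comp h2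

theorem abs_flow_sub_le (hG : FoldField G L M) (t s : ℝ) : |hG.flow t s - s| ≤ M * t ^ 2 := by
  have hM : 0 ≤ M := (abs_nonneg _).trans (hG.bound 0 0)
  have h := (convex_uIcc (0 : ℝ) t).norm_image_sub_le_of_norm_hasDerivWithin_le
    (f := fun t => hG.flow t s) (C := M * |t|)
    (fun τ _ => (hG.hasDerivAt_flow τ s).hasDerivWithinAt) (fun τ hτ => by
      refine (hG.bound_mul _ _).trans (mul_le_mul_of_nonneg_left ?_ hM)
      have := abs_sub_left_of_mem_uIcc hτ
      simpa using this) left_mem_uIcc right_mem_uIcc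
  simp only [flow_zero, Real.norm_eq_abs, sub_zero] at h
  rwa [mul_assoc, abs_mul_abs_self, ← sq] at h

/-- The other initial value of the two solutions `y(t)`, `y(-t)` through the point with
parameters `t` and `s`. -/
def dual (hG : FoldField G L M) (t s : ℝ) : ℝ := hG.initial (-t) (hG.flow t s)

theorem continuous_dual (hG : FoldField G L M) : Continuous (uncurry hG.dual) :=
  hG.continuous_initial.comp (continuous_fst.neg.prodMk hG.continuous_flow)

@[simp] theorem dual_zero (hG : FoldField G L M) (s : ℝ) : hG.dual 0 s = s := by simp [dual]

/-- A fencing argument: the reversed solution from `dual t₁ s` meets the solution from s at t₁, and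
wherever they meet its slope −G(−t, y) is below G(t, y). It therefore stays below until t₂. Time 0
is excluded because `pos` fails there. -/
theorem dual_le_dual (hG : FoldField G L M) (s : ℝ) {t₁ t₂ : ℝ} (h : t₁ ≤ t₂)
    (h0 : (0 : ℝ) ∉ Icc t₁ t₂) : hG.dual t₁ s ≤ hG.dual t₂ s := by
  set s₁ := hG.dual t₁ s with hs₁
  have key := image_le_of_deriv_right_lt_deriv_boundary' (a := t₁) (b := t₂)
    (f := fun t => hG.flow (-t) s₁) (f' := fun t => G (-t) (hG.flow (-t) s₁) * -1)
    (B := fun t => hG.flow t s) (B' := fun t => G t (hG.flow t s))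
    ((hG.continuous_sol 0 s₁).comp continuous_neg).continuousOn
    (fun t _ => (HasDerivAt.comp t (hG.hasDerivAt_flow (-t) s₁)
      (hasDerivAt_neg t)).hasDerivWithinAt)
    (by simp [hs₁, dual]) (hG.continuous_sol 0 s).continuousOn
    (fun t _ => (hG.hasDerivAt_flow t s).hasDerivWithinAt)
    (fun t ht hEq => by
      rw [hEq]
      have hne : t ≠ 0 := by
        rintro rfl
        exact h0 (Ico_subset_Icc_self ht)
      linarith [hG.pos t hne (hG.flow t s)])
  have h2 := key (right_mem_Icc.2 h)
  rw [← (hG.flow_strictMono (-t₂)).le_iff_le]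
  simpa [dual] using h2

/-- Equality would make the reversed solution agree with the solution on an interval, and comparing
derivatives would contradict `pos`. -/
theorem dual_lt_dual (hG : FoldField G L M) (s : ℝ) {t₁ t₂ : ℝ} (h : t₁ < t₂)
    (h0 : (0 : ℝ) ∉ Icc t₁ t₂) : hG.dual t₁ s < hG.dual t₂ s := by
  refine lt_of_le_of_ne (hG.dual_le_dual s h.le h0) fun hE => ?_
  have hconst : ∀ t ∈ Icc t₁ t₂, hG.flow (-t) (hG.dual t₁ s) = hG.flow t s := by
    intro t ht
    have e1 := hG.dual_le_dual s ht.1 fun hh => h0 ⟨hh.1, hh.2.trans ht.2⟩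
    have e2 := hG.dual_le_dual s ht.2 fun hh => h0 ⟨ht.1.trans hh.1, hh.2⟩
    have e3 : hG.dual t₁ s = hG.dual t s := le_antisymm e1 (hE ▸ e2)
    rw [e3]
    simp [dual]
  obtain ⟨t, ht⟩ := exists_between h
  have hne : t ≠ 0 := by
    rintro rfl
    exact h0 (Ioo_subset_Icc_self ht)
  have d1 := HasDerivAt.comp t (hG.hasDerivAt_flow (-t) (hG.dual t₁ s)) (hasDerivAt_neg t)
  have d2 := hG.hasDerivAt_flow t s
  have hev : (fun τ => hG.flow τ s) =ᶠ[𝓝 t]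
      ((fun τ => hG.flow τ (hG.dual t₁ s)) ∘ Neg.neg) := by
    filter_upwards [Ioo_mem_nhds ht.1 ht.2] with τ hτ
    exact (hconst τ (Ioo_subset_Icc_self hτ)).symm
  have hd := (d1.congr_of_eventuallyEq hev).unique d2
  rw [hconst t (Ioo_subset_Icc_self ht)] at hd
  linarith [hG.pos t hne (hG.flow t s)]

/-- The two half-lines are joined at t = 0 by continuity. -/
theorem dual_strictMono_fst (hG : FoldField G L M) (s : ℝ) :
    StrictMono fun t => hG.dual t s := by
  have hc : Continuous fun t => hG.dual t s :=
    hG.continuous_dual.comp (continuous_id.prodMk continuous_const)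
  have hpos : ∀ t, 0 < t → hG.dual 0 s < hG.dual t s := by
    intro t ht
    have h1 : hG.dual 0 s ≤ hG.dual (t / 2) s := by
      refine le_of_tendsto (x := 𝓝[>] 0) (hc.continuousAt.mono_left nhdsWithin_le_nhds) ?_
      filter_upwards [Ioo_mem_nhdsGT (half_pos ht)] with τ hτ
      exact hG.dual_le_dual s hτ.2.le fun hh => (not_le.2 hτ.1) hh.1
    exact h1.trans_lt (hG.dual_lt_dual s (half_lt_self ht) fun hh => by linarith [hh.1])
  have hneg : ∀ t, t < 0 → hG.dual t s < hG.dual 0 s := by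
    intro t ht
    have h1 : hG.dual (t / 2) s ≤ hG.dual 0 s := by
      refine ge_of_tendsto (x := 𝓝[<] 0) (hc.continuousAt.mono_left nhdsWithin_le_nhds) ?_
      filter_upwards [Ioo_mem_nhdsLT (show t / 2 < 0 by linarith)] with τ hτ
      exact hG.dual_le_dual s hτ.1.le fun hh => (not_le.2 hτ.2) hh.2
    exact (hG.dual_lt_dual s (show t < t / 2 by linarith)
      fun hh => by linarith [hh.2]).trans_le h1
  intro t₁ t₂ h
  by_cases h0 : (0 : ℝ) ∈ Icc t₁ t₂
  · rcases h0.1.lt_or_eq with h1 | rfl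
    · rcases h0.2.lt_or_eq with h2 | rfl
      · exact (hneg _ h1).trans (hpos _ h2)
      · exact hneg _ h1
    · exact hpos _ h
  · exact hG.dual_lt_dual s h h0

end FoldField

/-! ### The topological model of a fold -/

/-- The broken line with corner `(s, s)`, the model of a cuspidal integral curve. -/
def brokenLine (s τ : ℝ) : ℝ × ℝ := (s + max τ 0, s + min τ 0)

theorem brokenLine_injective (s : ℝ) : Injective (brokenLine s) := by
  intro a b h
  simp only [brokenLine, Prod.mk.injEq, add_right_inj] at h
  linarith [max_add_min a 0, max_add_min b 0]

/-- The nonempty open connected pieces of the broken lines. -/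
def IsBrokenArc (S : Set (ℝ × ℝ)) : Prop :=
  ∃ (s : ℝ) (T : Set ℝ), IsOpen T ∧ IsPreconnected T ∧ T.Nonempty ∧ S = brokenLine s '' T

namespace FoldField

variable {G : ℝ → ℝ → ℝ} {L : ℝ≥0} {M : ℝ}

/-- The initial values of the two solutions through the two points over `(r, v)`, that is, with
`t² = r`, extended to `r < 0`. -/
def foldMap (hG : FoldField G L M) (p : ℝ × ℝ) : ℝ × ℝ :=
  (hG.initial (-√p.1) p.2 + min p.1 0, hG.initial (√p.1) p.2)

/-- The map factors into two steps, each changing one coordinate by a fibrewise increasing function: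
first v becomes its initial value s at time √r, then r becomes `dual (√r) s + min r 0`. The term
`min r 0` provides strictness for r < 0, where √r = 0. -/
theorem isOpenEmbedding_foldMap (hG : FoldField G L M) : IsOpenEmbedding hG.foldMap := by
  have h1 : IsOpenEmbedding fun p : ℝ × ℝ => (p.1, hG.initial (√p.1) p.2) :=
    isOpenEmbedding_prodMk_snd (f := fun r v => hG.initial (√r) v)
      (hG.continuous_initial.comp
        ((Real.continuous_sqrt.comp continuous_fst).prodMk continuous_snd))
      fun r => hG.initial_strictMono _
  have h2 : IsOpenEmbedding fun p : ℝ × ℝ => (hG.dual (√p.1) p.2 + min p.1 0, p.2) := by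
    refine isOpenEmbedding_prodMk_fst (f := fun r s => hG.dual (√r) s + min r 0)
      ((hG.continuous_dual.comp
        ((Real.continuous_sqrt.comp continuous_fst).prodMk continuous_snd)).add
          (continuous_fst.min continuous_const)) fun s r₁ r₂ h => ?_
    rcases le_or_gt 0 r₁ with h0 | h0
    · have := hG.dual_strictMono_fst s (Real.sqrt_lt_sqrt h0 h)
      simp only [min_eq_right h0, min_eq_right (h0.trans h.le)]
      linarith
    · have h3 := (hG.dual_strictMono_fst s).monotone (Real.sqrt_le_sqrt h.le)
      have h4 : min r₁ 0 < min r₂ 0 := by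
        rw [min_eq_left h0.le]
        exact lt_min h h0
      simp only at h3 ⊢
      linarith
  convert h2.comp h1 using 1
  ext p <;> simp [foldMap, dual]

theorem foldMap_fst_eq_snd_iff (hG : FoldField G L M) (p : ℝ × ℝ) :
    (hG.foldMap p).1 = (hG.foldMap p).2 ↔ p.1 = 0 := by
  constructor
  · intro h
    rcases lt_trichotomy p.1 0 with h0 | h0 | h0
    · simp only [foldMap, Real.sqrt_eq_zero_of_nonpos h0.le, neg_zero, min_eq_left h0.le] at h
      linarith
    · exact h0
    · have h1 := hG.dual_strictMono_fst (hG.initial (√p.1) p.2) (Real.sqrt_pos.2 h0)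
      beta_reduce at h1
      rw [dual_zero, dual, flow_initial] at h1
      simp only [foldMap, min_eq_right h0.le, add_zero] at h
      exact absurd h h1.ne'
  · intro h
    simp [foldMap, h]

/-- For t ≥ 0 the root √(t²) is t and the second coordinate is s; for t ≤ 0 it is −t and the
coordinates exchange roles. Hence the corner at t = 0. -/
theorem foldMap_sq (hG : FoldField G L M) (s t : ℝ) :
    hG.foldMap (t ^ 2, hG.flow t s) = brokenLine s (hG.dual t s - s) := by
  have hm := (hG.dual_strictMono_fst s).monotone
  rcases le_total 0 t with h | h
  · have h1 : s ≤ hG.dual t s := by simpa using hm h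
    simp only [foldMap, brokenLine, Real.sqrt_sq h, initial_flow, min_eq_right (sq_nonneg t),
      max_eq_left (sub_nonneg.2 h1), min_eq_right (sub_nonneg.2 h1)]
    simp [dual]
  · have h1 : hG.dual t s ≤ s := by simpa using hm h
    have h2 : √(t ^ 2) = -t := by rw [← neg_sq, Real.sqrt_sq (neg_nonneg.2 h)]
    simp only [foldMap, brokenLine, h2, neg_neg, initial_flow, min_eq_right (sq_nonneg t),
      max_eq_right (sub_nonpos.2 h1), min_eq_left (sub_nonpos.2 h1)]
    simp [dual]

theorem exists_of_foldMap_eq (hG : FoldField G L M) {p : ℝ × ℝ} {s τ : ℝ}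
    (h : hG.foldMap p = brokenLine s τ) :
    ∃ t, p = (t ^ 2, hG.flow t s) ∧ hG.dual t s - s = τ := by
  suffices ∃ t, p = (t ^ 2, hG.flow t s) by
    obtain ⟨t, rfl⟩ := this
    exact ⟨t, rfl, brokenLine_injective s ((hG.foldMap_sq s t).symm.trans h)⟩
  have h1 := congrArg Prod.fst h
  have h2 := congrArg Prod.snd h
  have h0 : 0 ≤ p.1 := by
    by_contra! h0
    simp only [foldMap, brokenLine, Real.sqrt_eq_zero_of_nonpos h0.le, neg_zero,
      min_eq_left h0.le, initial_zero] at h1 h2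
    linarith [le_max_right τ 0, min_le_right τ 0]
  simp only [foldMap, brokenLine, min_eq_right h0, add_zero] at h1 h2
  rcases le_total 0 τ with hτ | hτ
  · refine ⟨√p.1, Prod.ext (Real.sq_sqrt h0).symm ?_⟩
    rw [min_eq_right hτ, add_zero] at h2
    rw [← h2, flow_initial]
  · refine ⟨-√p.1, Prod.ext (by rw [neg_sq, Real.sq_sqrt h0]) ?_⟩
    rw [max_eq_right hτ, add_zero] at h1
    rw [← h1, flow_initial]

/-- The parameters of the folded solution and of its broken line correspond by the increasing map t
↦ `dual t s - s`. It need not be onto, but `exists_of_foldMap_eq` supplies t for every point of the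
broken line in the image of `foldMap`. -/
theorem isBrokenArc_image_foldMap_iff (hG : FoldField G L M) (S : Set (ℝ × ℝ)) :
    IsBrokenArc (hG.foldMap '' S) ↔ ∃ (s : ℝ) (T : Set ℝ), IsOpen T ∧ IsPreconnected T ∧
      T.Nonempty ∧ S = (fun t => (t ^ 2, hG.flow t s)) '' T := by
  have hθc : ∀ s, Continuous fun t => hG.dual t s - s := fun s =>
    (hG.continuous_dual.comp (continuous_id.prodMk continuous_const)).sub continuous_const
  have hθm : ∀ s, StrictMono fun t => hG.dual t s - s := fun s a b hab =>
    sub_lt_sub_right (hG.dual_strictMono_fst s hab) s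
  constructor
  · rintro ⟨s, T, hTo, hTc, ⟨τ, hτ⟩, hS⟩
    refine ⟨s, (fun t => hG.dual t s - s) ⁻¹' T, hTo.preimage (hθc s), ?_, ?_, ?_⟩
    · exact (hTc.ordConnected.preimage_mono (hθm s).monotone).isPreconnected
    · have : brokenLine s τ ∈ hG.foldMap '' S := hS ▸ mem_image_of_mem _ hτ
      obtain ⟨p, -, hp⟩ := this
      obtain ⟨t, -, rfl⟩ := hG.exists_of_foldMap_eq hp
      exact ⟨t, hτ⟩
    · ext p
      constructor
      · intro hp
        have : hG.foldMap p ∈ brokenLine s '' T := hS ▸ mem_image_of_mem _ hp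
        obtain ⟨τ', hτ', hE⟩ := this
        obtain ⟨t, rfl, rfl⟩ := hG.exists_of_foldMap_eq hE.symm
        exact ⟨t, hτ', rfl⟩
      · rintro ⟨t, ht, rfl⟩
        have : brokenLine s (hG.dual t s - s) ∈ hG.foldMap '' S := hS ▸ mem_image_of_mem _ ht
        rw [← foldMap_sq] at this
        obtain ⟨p, hp, hE⟩ := this
        have hp' := hG.isOpenEmbedding_foldMap.injective hE
        subst hp'
        exact hp
  · rintro ⟨s, T, hTo, hTc, hTn, rfl⟩
    refine ⟨s, (fun t => hG.dual t s - s) '' T, isOpenMap_of_strictMono (hθc s) (hθm s) _ hTo,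
      hTc.image _ (hθc s).continuousOn, hTn.image _, ?_⟩
    simp only [image_image, foldMap_sq]

theorem flow_neg_ne (hG : FoldField G L M) {s t : ℝ} (ht : t ≠ 0) :
    hG.flow (-t) s ≠ hG.flow t s := by
  intro h
  have h1 : hG.dual t s = hG.dual 0 s := by rw [dual, ← h, initial_flow, dual_zero]
  exact ht ((hG.dual_strictMono_fst s).injective h1)

theorem injective_sq_flow (hG : FoldField G L M) (s : ℝ) :
    Injective fun t => (t ^ 2, hG.flow t s) := by
  intro a b h
  simp only [Prod.mk.injEq] at h
  rcases sq_eq_sq_iff_eq_or_eq_neg.1 h.1 with h1 | rfl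
  · exact h1
  · by_contra hb
    have : b ≠ 0 := by
      rintro rfl
      simp at hb
    exact hG.flow_neg_ne this h.2

end FoldField

/-! ### Configurations of cusp type and their charts -/

/-- Near the origin the configuration is given by `(dv + f du)² = r du²`, the discriminant curve
`r = 0` being regular and transverse to the configuration at the origin. -/
def Configuration.IsCuspType (K : Configuration) : Prop :=
  ∃ (f r : ℝ × ℝ → ℝ) (N : Set (ℝ × ℝ)), IsOpen N ∧ (0, 0) ∈ N ∧ N ⊆ K.domain ∧
    ContDiffOn ℝ ∞ f N ∧ ContDiffOn ℝ ∞ r N ∧ f (0, 0) = 0 ∧ r (0, 0) = 0 ∧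
    fderiv ℝ r (0, 0) (1, 0) ≠ 0 ∧
    (∀ x ∈ N, ∀ w : ℝ × ℝ, K.dir x w ↔ (w.2 + f x * w.1) ^ 2 = r x * w.1 ^ 2) ∧
    (∀ x ∈ N, x ∈ K.disc ↔ r x = 0) ∧ ∀ x ∈ N, x ∉ K.sing

/-- The factor `P` with `P u' = r'` along the curves `v' + f u' = σ t u'`, `t² = r`. -/
def speed (f r : ℝ × ℝ → ℝ) (σ t : ℝ) (x : ℝ × ℝ) : ℝ :=
  fderiv ℝ r x (1, 0) + fderiv ℝ r x (0, 1) * (σ * t - f x)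

/-- Coordinates `(r, v)` near the origin in which a configuration of cusp type is the image
of the solutions of `v' = G(t, v)` under `(t, v) ↦ (t², v)`. -/
structure CuspChart (K : Configuration) where
  (f r : ℝ × ℝ → ℝ)
  (σ ε M : ℝ)
  (L C : ℝ≥0)
  (G slope : ℝ → ℝ → ℝ)
  chart : OpenPartialHomeomorph (ℝ × ℝ) (ℝ × ℝ)
  field : FoldField G L M
  σ_mul : σ * σ = 1
  ε_pos : 0 < ε
  zero_mem : (0, 0) ∈ chart.source
  chart_zero : chart (0, 0) = (0, 0)
  chart_apply : ∀ x ∈ chart.source, chart x = (r x, x.2)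
  target_fst : ∀ y ∈ chart.target, |y.1| < ε ^ 2
  target_snd : ∀ y ∈ chart.target, |y.2| < ε
  source_subset : chart.source ⊆ K.domain
  dir_iff : ∀ x ∈ chart.source, ∀ w : ℝ × ℝ,
    K.dir x w ↔ (w.2 + f x * w.1) ^ 2 = r x * w.1 ^ 2
  disc_iff : ∀ x ∈ chart.source, x ∈ K.disc ↔ r x = 0
  notMem_sing : ∀ x ∈ chart.source, x ∉ K.sing
  contDiffAt_f : ∀ x ∈ chart.source, ContDiffAt ℝ ∞ f x
  contDiffAt_r : ∀ x ∈ chart.source, ContDiffAt ℝ ∞ r x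
  contDiffAt_symm : ∀ y ∈ chart.target, ContDiffAt ℝ ∞ chart.symm y
  fderiv_ne : ∀ x ∈ chart.source, fderiv ℝ r x (1, 0) ≠ 0
  speed_ne : ∀ x ∈ chart.source, ∀ t, t ^ 2 = r x → speed f r σ t x ≠ 0
  slope_mul : ∀ x ∈ chart.source, ∀ t, t ^ 2 = r x →
    slope t x.2 * speed f r σ t x = σ * t - f x
  slope_lipschitz : ∀ t, LipschitzWith C (slope t)
  field_eq : ∀ t y, |t| < ε → G t y = 2 * t * slope t y
  contDiffOn_field : ContDiffOn ℝ ∞ (uncurry G) (Ioo (-ε) ε ×ˢ Ioo (-ε) ε)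

/-- The linear automorphism `w ↦ (l w, w₂)`. -/
def shearEquiv (l : ℝ × ℝ →L[ℝ] ℝ) (hl : l (1, 0) ≠ 0) : (ℝ × ℝ) ≃L[ℝ] (ℝ × ℝ) :=
  ContinuousLinearEquiv.equivOfInverse (l.prod (ContinuousLinearMap.snd ℝ ℝ ℝ))
    (((l (1, 0))⁻¹ • (ContinuousLinearMap.fst ℝ ℝ ℝ -
      l (0, 1) • ContinuousLinearMap.snd ℝ ℝ ℝ)).prod (ContinuousLinearMap.snd ℝ ℝ ℝ))
    (fun w => by
      have h : l w = w.1 * l (1, 0) + w.2 * l (0, 1) := by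
        conv_lhs => rw [show w = w.1 • ((1 : ℝ), (0 : ℝ)) + w.2 • ((0 : ℝ), (1 : ℝ)) by ext <;> simp]
        rw [map_add, map_smul, map_smul, smul_eq_mul, smul_eq_mul]
      ext
      · simp [h]
        field_simp
        ring
      · simp)
    (fun w => by
      ext
      · set z : ℝ × ℝ := (((l (1, 0))⁻¹ • (ContinuousLinearMap.fst ℝ ℝ ℝ -
          l (0, 1) • ContinuousLinearMap.snd ℝ ℝ ℝ)).prod (ContinuousLinearMap.snd ℝ ℝ ℝ)) w with hz
        have h : l z = z.1 * l (1, 0) + z.2 * l (0, 1) := by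
          conv_lhs => rw [show z = z.1 • ((1 : ℝ), (0 : ℝ)) + z.2 • ((0 : ℝ), (1 : ℝ)) by
            ext <;> simp]
          rw [map_add, map_smul, map_smul, smul_eq_mul, smul_eq_mul]
        change l z = w.1
        rw [h, hz]
        simp
        field_simp
        ring
      · simp)

theorem shearEquiv_coe (l : ℝ × ℝ →L[ℝ] ℝ) (hl : l (1, 0) ≠ 0) :
    (shearEquiv l hl : ℝ × ℝ →L[ℝ] ℝ × ℝ) = l.prod (ContinuousLinearMap.snd ℝ ℝ ℝ) := rfl

theorem hasFDerivAt_prodMk_snd {r : ℝ × ℝ → ℝ} {x : ℝ × ℝ} (hr : ContDiffAt ℝ ∞ r x)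
    (hx : fderiv ℝ r x (1, 0) ≠ 0) :
    HasFDerivAt (fun y : ℝ × ℝ => (r y, y.2))
      (shearEquiv (fderiv ℝ r x) hx : ℝ × ℝ →L[ℝ] ℝ × ℝ) x := by
  rw [shearEquiv_coe]
  exact (hr.differentiableAt (by simp)).hasFDerivAt.prodMk hasFDerivAt_snd

/-- The coordinates `(r, v)` near a point where `r_u ≠ 0`. -/
theorem exists_chart_prodMk_snd {r : ℝ × ℝ → ℝ} {N : Set (ℝ × ℝ)} {x : ℝ × ℝ} (hN : IsOpen N)
    (hxN : x ∈ N) (hr : ContDiffOn ℝ ∞ r N) (hx : fderiv ℝ r x (1, 0) ≠ 0) :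
    ∃ Θ : OpenPartialHomeomorph (ℝ × ℝ) (ℝ × ℝ), x ∈ Θ.source ∧ Θ.source ⊆ N ∧
      (∀ y, Θ y = (r y, y.2)) ∧ (∀ y ∈ Θ.source, fderiv ℝ r y (1, 0) ≠ 0) ∧
      ∀ y ∈ Θ.target, ContDiffAt ℝ ∞ Θ.symm y := by
  have hr' : ∀ y ∈ N, ContDiffAt ℝ ∞ r y := fun y hy => hr.contDiffAt (hN.mem_nhds hy)
  have hF : ContDiffAt ℝ ∞ (fun y : ℝ × ℝ => (r y, y.2)) x := (hr' x hxN).prodMk contDiffAt_snd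
  have hc : ContinuousOn (fun y => fderiv ℝ r y (1, 0)) N := fun y hy =>
    (((hr' y hy).fderiv_right (m := 0) (by simp)).continuousAt.clm_apply
      continuousAt_const).continuousWithinAt
  have hO : IsOpen (N ∩ (fun y => fderiv ℝ r y (1, 0)) ⁻¹' {0}ᶜ) :=
    hc.isOpen_inter_preimage hN isOpen_compl_singleton
  refine ⟨(hF.toOpenPartialHomeomorph _ (hasFDerivAt_prodMk_snd (hr' x hxN) hx)
    (by simp)).restrOpen _ hO, ?_, ?_, ?_, ?_, ?_⟩
  · exact ⟨hF.mem_toOpenPartialHomeomorph_source _ _, hxN, hx⟩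
  · exact fun y hy => hy.2.1
  · exact fun y => rfl
  · exact fun y hy => hy.2.2
  · intro y hy
    set Θ := (hF.toOpenPartialHomeomorph _ (hasFDerivAt_prodMk_snd (hr' x hxN) hx)
      (by simp)).restrOpen _ hO with hΘ
    have hs : Θ.symm y ∈ Θ.source := Θ.map_target hy
    exact Θ.contDiffAt_symm hy (hasFDerivAt_prodMk_snd (hr' _ hs.2.1) hs.2.2)
      ((hr' _ hs.2.1).prodMk contDiffAt_snd)

/-- Truncation to `[-ε, ε]`. -/
def trunc (ε x : ℝ) : ℝ := max (-ε) (min x ε)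

theorem lipschitzWith_trunc (ε : ℝ) : LipschitzWith 1 (trunc ε) :=
  (LipschitzWith.id.min_const ε).const_max (-ε)

theorem trunc_neg {ε : ℝ} (hε : 0 ≤ ε) (x : ℝ) : trunc ε (-x) = -trunc ε x := by
  unfold trunc
  grind

theorem abs_trunc_le {ε : ℝ} (hε : 0 ≤ ε) (x : ℝ) : |trunc ε x| ≤ ε :=
  abs_le.2 ⟨le_max_left _ _, max_le (by linarith) (min_le_right _ _)⟩

theorem trunc_of_abs_le {ε x : ℝ} (hx : |x| ≤ ε) : trunc ε x = x := by
  rw [abs_le] at hx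
  rw [trunc, min_eq_left hx.2, max_eq_right hx.1]

theorem trunc_pos {ε x : ℝ} (hε : 0 < ε) (hx : 0 < x) : 0 < trunc ε x :=
  lt_max_of_lt_right (lt_min hx hε)

theorem abs_trunc_le_abs {ε : ℝ} (hε : 0 ≤ ε) (x : ℝ) : |trunc ε x| ≤ |x| := by
  have h := (lipschitzWith_trunc ε).dist_le_mul x 0
  have h0 : trunc ε 0 = 0 := trunc_of_abs_le (by simpa using hε)
  simpa [h0, Real.dist_eq] using h

/-- The truncated equation `v' = 2 t k(t, v)`. -/
theorem foldField_trunc {k : ℝ × ℝ → ℝ} {ε : ℝ} {C : ℝ≥0} (hε : 0 < ε) (hε1 : ε ≤ 1)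
    (hk0 : k (0, 0) = 0) (hk : LipschitzOnWith C k (Icc (-ε) ε ×ˢ Icc (-ε) ε))
    (hm : ∀ t ∈ Ioc 0 ε, ∀ v ∈ Icc (-ε) ε, k (-t, v) < k (t, v)) :
    FoldField (fun t v => 2 * trunc ε t * k (trunc ε t, trunc ε v)) (2 * C) (2 * C) := by
  have hmem : ∀ t v, (trunc ε t, trunc ε v) ∈ Icc (-ε) ε ×ˢ Icc (-ε) ε := fun t v =>
    ⟨abs_le.1 (abs_trunc_le hε.le t), abs_le.1 (abs_trunc_le hε.le v)⟩
  -- As k vanishes at the origin and the box has radius ε ≤ 1, the Lipschitz constant also bounds k.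
  have hb : ∀ t v, |k (trunc ε t, trunc ε v)| ≤ C := by
    intro t v
    have h := hk.dist_le_mul _ (hmem t v) (0, 0) ⟨by simp [hε.le], by simp [hε.le]⟩
    rw [hk0, Real.dist_eq, sub_zero] at h
    refine h.trans (mul_le_of_le_one_right C.2 ?_)
    rw [Prod.dist_eq, max_le_iff]
    simp only [Real.dist_eq, sub_zero]
    exact ⟨(abs_trunc_le hε.le t).trans hε1, (abs_trunc_le hε.le v).trans hε1⟩
  have hc : Continuous fun p : ℝ × ℝ => (trunc ε p.1, trunc ε p.2) :=
    ((lipschitzWith_trunc ε).continuous.comp continuous_fst).prodMk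
      ((lipschitzWith_trunc ε).continuous.comp continuous_snd)
  -- Truncation is odd, so with T = `trunc ε t` and V = `trunc ε v` the sum is 2T (k(T, V) − k(−T,
  -- V)).
  have hpos : ∀ t, 0 < t → ∀ v, 0 < 2 * trunc ε t * k (trunc ε t, trunc ε v) +
      2 * trunc ε (-t) * k (trunc ε (-t), trunc ε v) := by
    intro t ht v
    have h1 := hm (trunc ε t) ⟨trunc_pos hε ht, (abs_le.1 (abs_trunc_le hε.le t)).2⟩
      (trunc ε v) (abs_le.1 (abs_trunc_le hε.le v))
    rw [trunc_neg hε.le]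
    have := mul_pos (trunc_pos hε ht) (sub_pos.2 h1)
    linarith
  refine ⟨?_, ?_, ?_, ?_, ?_⟩
  · exact (continuous_const.mul ((lipschitzWith_trunc ε).continuous.comp continuous_fst)).mul
      (hk.continuousOn.comp_continuous hc fun p => hmem p.1 p.2)
  · intro t
    refine LipschitzWith.of_dist_le_mul fun v w => ?_
    have h := hk.dist_le_mul _ (hmem t v) _ (hmem t w)
    have h2 := (lipschitzWith_trunc ε).dist_le_mul v w
    have h3 : |2 * trunc ε t| ≤ 2 := by
      rw [abs_mul, abs_two]
      linarith [abs_trunc_le hε.le t]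
    simp only [Prod.dist_eq, dist_self, dist_nonneg, sup_of_le_right] at h
    rw [Real.dist_eq] at h
    rw [Real.dist_eq, ← mul_sub, abs_mul]
    push_cast at h2 ⊢
    rw [one_mul] at h2
    calc _ ≤ 2 * (C * dist v w) := by
          refine mul_le_mul h3 (h.trans ?_) (abs_nonneg _) (by norm_num)
          exact mul_le_mul_of_nonneg_left h2 C.2
      _ = _ := by ring
  · intro t v
    rw [abs_mul, abs_mul, abs_two]
    refine mul_le_mul ?_ (hb t v) (abs_nonneg _) (by norm_num)
    linarith [abs_trunc_le hε.le t]
  · intro t v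
    rw [abs_mul, abs_mul, abs_two]
    calc _ ≤ 2 * |t| * C := by
          refine mul_le_mul ?_ (hb t v) (abs_nonneg _) (by positivity)
          linarith [abs_trunc_le_abs hε.le t]
      _ = _ := by ring
  · intro t ht v
    rcases ht.lt_or_gt with h | h
    · have := hpos (-t) (by linarith) v
      rw [neg_neg] at this
      linarith
    · exact hpos t h v

theorem hasDerivAt_comp_curve {E F : Type*} [NormedAddCommGroup E] [NormedSpace ℝ E]
    [NormedAddCommGroup F] [NormedSpace ℝ F] {l : E → F} {l' : E →L[ℝ] F} {c : ℝ → E} {c' y : E}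
    {t : ℝ} (hl : HasFDerivAt l l' y) (hc : HasDerivAt c c' t) (hy : c t = y) :
    HasDerivAt (fun τ => l (c τ)) (l' c') t := by
  subst hy
  exact hl.comp_hasDerivAt t hc

/-- A function with positive `t`-derivative at the origin increases in `t` near the origin. -/
theorem eventually_strictMono_fst {k : ℝ × ℝ → ℝ} (hk : ContDiffAt ℝ 1 k (0, 0)) {c : ℝ}
    (hc : 0 < c) (hd : HasDerivAt (fun t => k (t, 0)) c 0) :
    ∃ C : ℝ≥0, ∃ δ > 0, ∀ ε, ε < δ → LipschitzOnWith C k (Icc (-ε) ε ×ˢ Icc (-ε) ε) ∧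
      ∀ t ∈ Ioc 0 ε, ∀ v ∈ Icc (-ε) ε, k (-t, v) < k (t, v) := by
  obtain ⟨C, S, hS, hL⟩ := hk.exists_lipschitzOnWith
  have hst := hk.hasStrictFDerivAt (by simp)
  have hval : fderiv ℝ k (0, 0) (1, 0) = c := by
    have h1 : HasDerivAt (fun t : ℝ => (t, (0 : ℝ))) (1, 0) 0 :=
      (hasDerivAt_id 0).prodMk (hasDerivAt_const 0 0)
    exact (hasDerivAt_comp_curve hst.hasFDerivAt h1 rfl).unique hd
  have hb := hst.isLittleO.def (half_pos hc)
  obtain ⟨δ₁, hδ₁, hb⟩ := Metric.eventually_nhds_iff_ball.1 hb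
  obtain ⟨δ₂, hδ₂, hS⟩ := Metric.mem_nhds_iff.1 hS
  refine ⟨C, min δ₁ δ₂, by positivity, fun ε hε => ⟨hL.mono fun p hp => hS ?_, ?_⟩⟩
  · rw [Metric.mem_ball, Prod.dist_eq, max_lt_iff, Real.dist_eq, Real.dist_eq, sub_zero, sub_zero]
    have h := hε.trans_le (min_le_right _ _)
    exact ⟨(abs_le.2 hp.1).trans_lt h, (abs_le.2 hp.2).trans_lt h⟩
  · intro t ht v hv
    have h := hε.trans_le (min_le_left _ _)
    have ht' : |t| < δ₁ := (abs_le.2 ⟨by linarith [ht.1, ht.2], ht.2⟩).trans_lt h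
    have hv' : |v| < δ₁ := (abs_le.2 hv).trans_lt h
    -- Strict differentiability compares two points both distinct from the origin: with relative
    -- error c/2 it gives k(t, v) − k(−t, v) ≥ 2tc − tc > 0.
    have h2 := hb ((t, v), (-t, v)) (by
      simp only [Metric.mem_ball, Prod.dist_eq, Real.dist_eq, sub_zero, abs_neg, max_lt_iff]
      exact ⟨⟨ht', hv'⟩, ht', hv'⟩)
    have h3 : ((t, v) : ℝ × ℝ) - (-t, v) = (2 * t) • ((1 : ℝ), (0 : ℝ)) := by
      ext <;> simp
      ring
    simp only [h3, map_smul, hval, norm_smul, Real.norm_eq_abs, smul_eq_mul] at h2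
    have h4 : ‖((1 : ℝ), (0 : ℝ))‖ = 1 := by simp [Prod.norm_def]
    rw [h4, abs_of_pos (by linarith [ht.1] : 0 < 2 * t)] at h2
    have h5 := (abs_le.1 h2).1
    nlinarith [mul_pos ht.1 hc]

theorem Configuration.IsCuspType.nonempty_cuspChart {K : Configuration} (hK : K.IsCuspType) :
    Nonempty (CuspChart K) := by
  obtain ⟨f, r, N, hN, h0N, hND, hf, hr, hf0, hr0, hru, hdir, hdisc, hsing⟩ := hK
  obtain ⟨Θ, h0Θ, hΘN, hΘ, hΘu, hΘs⟩ := exists_chart_prodMk_snd hN h0N hr hru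
  have hΘ0 : Θ (0, 0) = (0, 0) := by rw [hΘ, hr0]
  have hf' : ∀ y ∈ N, ContDiffAt ℝ ∞ f y := fun y hy => hf.contDiffAt (hN.mem_nhds hy)
  have hr' : ∀ y ∈ N, ContDiffAt ℝ ∞ r y := fun y hy => hr.contDiffAt (hN.mem_nhds hy)
  -- Choosing for σ the sign of r_u at the origin makes k increasing in t.
  obtain ⟨σ, hσ, hσpos⟩ : ∃ σ : ℝ, σ * σ = 1 ∧ 0 < σ / fderiv ℝ r (0, 0) (1, 0) := by
    rcases hru.lt_or_gt with h | h
    · exact ⟨-1, by norm_num, div_pos_of_neg_of_neg (by norm_num) h⟩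
    · exact ⟨1, by norm_num, div_pos one_pos h⟩
  set g : ℝ × ℝ → ℝ × ℝ := fun p => Θ.symm (p.1 ^ 2, p.2) with hg
  set P : ℝ × ℝ → ℝ := fun p => speed f r σ p.1 (g p) with hP
  -- Along dv = (σ t − f) du one has dr = P du, so k = dv/dr, and r = t² gives dv/dt = 2 t k.
  set k : ℝ × ℝ → ℝ := fun p => (σ * p.1 - f (g p)) / P p with hk
  have hsq : ContDiff ℝ ∞ fun p : ℝ × ℝ => (p.1 ^ 2, p.2) :=
    (contDiff_fst.pow 2).prodMk contDiff_snd
  have hgc : ∀ p : ℝ × ℝ, (p.1 ^ 2, p.2) ∈ Θ.target → ContDiffAt ℝ ∞ g p := fun p hp =>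
    (hΘs _ hp).comp p hsq.contDiffAt
  have hgN : ∀ p : ℝ × ℝ, (p.1 ^ 2, p.2) ∈ Θ.target → g p ∈ N := fun p hp =>
    hΘN (Θ.map_target hp)
  have hfg : ∀ p : ℝ × ℝ, (p.1 ^ 2, p.2) ∈ Θ.target →
      ContDiffAt ℝ ∞ (fun p => σ * p.1 - f (g p)) p := fun p hp =>
    (contDiffAt_const.mul contDiffAt_fst).sub ((hf' _ (hgN p hp)).comp p (hgc p hp))
  have hPc : ∀ p : ℝ × ℝ, (p.1 ^ 2, p.2) ∈ Θ.target → ContDiffAt ℝ ∞ P p := by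
    intro p hp
    have h1 : ContDiffAt ℝ ∞ (fun p => fderiv ℝ r (g p)) p :=
      ((hr' _ (hgN p hp)).fderiv_right (m := ∞) (by simp)).comp p (hgc p hp)
    exact (h1.clm_apply contDiffAt_const).add ((h1.clm_apply contDiffAt_const).mul (hfg p hp))
  have hkc : ∀ p : ℝ × ℝ, (p.1 ^ 2, p.2) ∈ Θ.target → P p ≠ 0 → ContDiffAt ℝ ∞ k p :=
    fun p hp hp' => (hfg p hp).div (hPc p hp) hp'
  have h0t : (((0 : ℝ × ℝ).1) ^ 2, (0 : ℝ × ℝ).2) ∈ Θ.target := by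
    have := Θ.map_source h0Θ
    rw [hΘ0] at this
    simpa using this
  have hg0 : g 0 = (0, 0) := by
    have := Θ.left_inv h0Θ
    rw [hΘ0] at this
    simpa [hg] using this
  have hP0 : P 0 = fderiv ℝ r (0, 0) (1, 0) := by
    simp [hP, speed, hg0, hf0]
  have hk0 : k (0, 0) = 0 := by
    have hg0' : g (0, 0) = (0, 0) := hg0
    simp [hk, hg0', hf0]
  -- Since g depends on t only through t², f ∘ g has zero t-derivative at 0; the numerator σ t − f ∘
  -- g vanishes there with derivative σ.
  have hkd : HasDerivAt (fun t => k (t, 0)) (σ / fderiv ℝ r (0, 0) (1, 0)) 0 := by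
    have hcurve : HasDerivAt (fun t : ℝ => (t ^ 2, (0 : ℝ))) (0, 0) 0 := by
      simpa using ((hasDerivAt_id (0 : ℝ)).pow 2).prodMk (hasDerivAt_const (0 : ℝ) (0 : ℝ))
    have hgd : HasDerivAt (fun t : ℝ => g (t, 0)) 0 0 := by
      have h1 : HasFDerivAt Θ.symm (fderiv ℝ Θ.symm ((0 : ℝ) ^ 2, (0 : ℝ))) ((0 : ℝ) ^ 2, (0 : ℝ)) :=
        ((hΘs _ h0t).differentiableAt (by simp)).hasFDerivAt
      have h2 := hasDerivAt_comp_curve h1 hcurve rfl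
      rwa [Prod.mk_zero_zero, map_zero] at h2
    have hfd : HasDerivAt (fun t : ℝ => f (g (t, 0))) 0 0 := by
      have h1 : HasFDerivAt f (fderiv ℝ f (g (0, 0))) (g (0, 0)) :=
        ((hf' _ (hgN 0 h0t)).differentiableAt (by simp)).hasFDerivAt
      simpa using hasDerivAt_comp_curve h1 hgd rfl
    have hnum : HasDerivAt (fun t : ℝ => σ * t - f (g (t, 0))) σ 0 := by
      exact (((hasDerivAt_id (0 : ℝ)).const_mul σ).sub hfd).congr_deriv (by simp)
    have hden : DifferentiableAt ℝ (fun t : ℝ => P (t, 0)) 0 :=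
      (hasDerivAt_comp_curve (c := fun t : ℝ => (t, (0 : ℝ)))
        ((hPc 0 h0t).differentiableAt (by simp)).hasFDerivAt
        ((hasDerivAt_id 0).prodMk (hasDerivAt_const 0 0)) rfl).differentiableAt
    have hP0' : P ((0 : ℝ), (0 : ℝ)) ≠ 0 := by
      change P 0 ≠ 0
      rwa [hP0]
    have hfg0 : f (g ((0 : ℝ), (0 : ℝ))) = 0 := by
      change f (g 0) = 0
      rw [hg0, hf0]
    refine (hnum.div hden.hasDerivAt hP0').congr_deriv ?_
    rw [hfg0, show P ((0 : ℝ), (0 : ℝ)) = fderiv ℝ r (0, 0) (1, 0) from hP0]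
    field_simp
    ring
  have hP0n : P 0 ≠ 0 := by rwa [hP0]
  obtain ⟨C, δ, hδ, hbox⟩ := eventually_strictMono_fst
    ((hkc 0 h0t hP0n).of_le (by simp)) hσpos hkd
  have hW : ∀ᶠ p : ℝ × ℝ in 𝓝 0, (p.1 ^ 2, p.2) ∈ Θ.target ∧ P p ≠ 0 :=
    (hsq.continuous.continuousAt.eventually (Θ.open_target.mem_nhds h0t)).and
      ((hPc 0 h0t).continuousAt.eventually_ne hP0n)
  obtain ⟨η, hη, hW⟩ := Metric.eventually_nhds_iff_ball.1 hW
  set ε : ℝ := min (min (δ / 2) (η / 2)) 1 with hε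
  have hεpos : 0 < ε := by positivity
  have hε1 : ε ≤ 1 := min_le_right _ _
  have hεδ : ε < δ := ((min_le_left _ _).trans (min_le_left _ _)).trans_lt (half_lt_self hδ)
  have hεη : ε < η := ((min_le_left _ _).trans (min_le_right _ _)).trans_lt (half_lt_self hη)
  have hWε : ∀ t v : ℝ, |t| ≤ ε → |v| ≤ ε → (t ^ 2, v) ∈ Θ.target ∧ P (t, v) ≠ 0 := by
    intro t v ht hv
    refine hW (t, v) ?_
    rw [mem_ball_zero_iff, Prod.norm_def, max_lt_iff]
    exact ⟨ht.trans_lt hεη, hv.trans_lt hεη⟩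
  obtain ⟨hLip, hmono⟩ := hbox ε hεδ
  have hF := foldField_trunc hεpos hε1 hk0 hLip hmono
  have hBo : IsOpen {y : ℝ × ℝ | |y.1| < ε ^ 2 ∧ |y.2| < ε} :=
    (isOpen_lt continuous_fst.abs continuous_const).inter
      (isOpen_lt continuous_snd.abs continuous_const)
  -- With |r| < ε² and |v| < ε, any t with t² = r satisfies |t| < ε, so truncation is inactive on
  -- the chart.
  set Θ' := Θ.trans (OpenPartialHomeomorph.ofSet _ hBo) with hΘ'
  have hsrc : ∀ x, x ∈ Θ'.source ↔ x ∈ Θ.source ∧ |r x| < ε ^ 2 ∧ |x.2| < ε := by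
    intro x
    simp [hΘ', hΘ]
  have htgt : ∀ y, y ∈ Θ'.target ↔ (|y.1| < ε ^ 2 ∧ |y.2| < ε) ∧ y ∈ Θ.target := by
    intro x
    simp [hΘ']
  have habs : ∀ t : ℝ, |t ^ 2| < ε ^ 2 → |t| < ε := fun t h => by
    rw [abs_of_nonneg (sq_nonneg t)] at h
    exact abs_lt_of_sq_lt_sq h hεpos.le
  have hgx : ∀ x ∈ Θ'.source, ∀ t, t ^ 2 = r x → g (t, x.2) = x := by
    intro x hx t ht
    have := Θ.left_inv ((hsrc x).1 hx).1
    rw [hΘ, ← ht] at this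
    exact this
  have hPx : ∀ x ∈ Θ'.source, ∀ t, t ^ 2 = r x → speed f r σ t x ≠ 0 := by
    intro x hx t ht
    have h1 := ((hsrc x).1 hx).2
    rw [← ht] at h1
    have h2 := (hWε t x.2 (habs t h1.1).le h1.2.le).2
    simp only [hP] at h2
    rwa [hgx x hx t ht] at h2
  refine ⟨{
    f := f, r := r, σ := σ, ε := ε, M := 2 * C, L := 2 * C, C := C
    G := fun t v => 2 * trunc ε t * k (trunc ε t, trunc ε v)
    slope := fun t v => k (trunc ε t, trunc ε v)
    chart := Θ'
    field := hF
    σ_mul := hσ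
    ε_pos := hεpos
    zero_mem := (hsrc _).2 ⟨h0Θ, by rw [hr0, abs_zero]; positivity, by simpa using hεpos⟩
    chart_zero := hΘ0
    chart_apply := fun x _ => hΘ x
    target_fst := fun y hy => ((htgt y).1 hy).1.1
    target_snd := fun y hy => ((htgt y).1 hy).1.2
    source_subset := fun x hx => hND (hΘN ((hsrc x).1 hx).1)
    dir_iff := fun x hx => hdir x (hΘN ((hsrc x).1 hx).1)
    disc_iff := fun x hx => hdisc x (hΘN ((hsrc x).1 hx).1)
    notMem_sing := fun x hx => hsing x (hΘN ((hsrc x).1 hx).1)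
    contDiffAt_f := fun x hx => hf' x (hΘN ((hsrc x).1 hx).1)
    contDiffAt_r := fun x hx => hr' x (hΘN ((hsrc x).1 hx).1)
    contDiffAt_symm := fun y hy => hΘs y ((htgt y).1 hy).2
    fderiv_ne := fun x hx => hΘu x ((hsrc x).1 hx).1
    speed_ne := hPx
    slope_mul := ?_
    slope_lipschitz := ?_
    field_eq := ?_
    contDiffOn_field := ?_ }⟩
  · intro x hx t ht
    have h1 := ((hsrc x).1 hx).2
    rw [← ht] at h1
    rw [trunc_of_abs_le (habs t h1.1).le, trunc_of_abs_le h1.2.le]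
    simp only [hk, hP, hgx x hx t ht]
    exact div_mul_cancel₀ _ (hPx x hx t ht)
  · intro t
    refine LipschitzWith.of_dist_le_mul fun v w => ?_
    have h := hLip.dist_le_mul (trunc ε t, trunc ε v)
      ⟨abs_le.1 (abs_trunc_le hεpos.le t), abs_le.1 (abs_trunc_le hεpos.le v)⟩
      (trunc ε t, trunc ε w)
      ⟨abs_le.1 (abs_trunc_le hεpos.le t), abs_le.1 (abs_trunc_le hεpos.le w)⟩
    have h2 := (lipschitzWith_trunc ε).dist_le_mul v w
    rw [NNReal.coe_one, one_mul] at h2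
    simp only [Prod.dist_eq, dist_self, dist_nonneg, sup_of_le_right] at h
    exact h.trans (mul_le_mul_of_nonneg_left h2 C.2)
  · intro t y ht
    rw [trunc_of_abs_le ht.le]
  · have hkO : ContDiffOn ℝ ∞ (fun p : ℝ × ℝ => 2 * p.1 * k p) (Ioo (-ε) ε ×ˢ Ioo (-ε) ε) := by
      rintro ⟨t, v⟩ ⟨ht, hv⟩
      have h := hWε t v (abs_le.2 ⟨ht.1.le, ht.2.le⟩) (abs_le.2 ⟨hv.1.le, hv.2.le⟩)
      exact ((contDiffAt_const.mul contDiffAt_fst).mul (hkc (t, v) h.1 h.2)).contDiffWithinAt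
    refine hkO.congr ?_
    rintro ⟨t, v⟩ ⟨ht, hv⟩
    simp only [uncurry]
    rw [trunc_of_abs_le (abs_le.2 ⟨ht.1.le, ht.2.le⟩), trunc_of_abs_le (abs_le.2 ⟨hv.1.le, hv.2.le⟩)]

theorem _root_.IsPreconnected.eq_Ioo_of_isOpen {T : Set ℝ} (hc : IsPreconnected T) (ho : IsOpen T)
    (hne : T.Nonempty) (hb : BddBelow T) (hb' : BddAbove T) :
    sInf T < sSup T ∧ T = Ioo (sInf T) (sSup T) := by
  have hlt : ∀ t ∈ T, sInf T < t ∧ t < sSup T := by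
    intro t ht
    obtain ⟨δ, hδ, hT⟩ := Metric.isOpen_iff.1 ho t ht
    rw [Real.ball_eq_Ioo] at hT
    have h1 := csInf_le hb (hT (show t - δ / 2 ∈ _ by constructor <;> linarith))
    have h2 := le_csSup hb' (hT (show t + δ / 2 ∈ _ by constructor <;> linarith))
    constructor <;> linarith
  refine ⟨(hlt _ hne.some_mem).1.trans (hlt _ hne.some_mem).2, ?_⟩
  exact Subset.antisymm hlt (IsConnected.Ioo_csInf_csSup_subset ⟨hne, hc⟩ hb hb')

theorem isOpen_image_Ioo_of_injOn {t : ℝ → ℝ} {a b : ℝ} (hc : ContinuousOn t (Ioo a b))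
    (hi : InjOn t (Ioo a b)) : IsOpen (t '' Ioo a b) := by
  rw [isOpen_iff_mem_nhds]
  rintro _ ⟨τ, hτ, rfl⟩
  obtain ⟨τ₁, h₁, h₁'⟩ := exists_between hτ.1
  obtain ⟨τ₂, h₂, h₂'⟩ := exists_between hτ.2
  have hsub : Icc τ₁ τ₂ ⊆ Ioo a b := fun x hx => ⟨h₁.trans_le hx.1, hx.2.trans_lt h₂'⟩
  have hτ' : τ ∈ Icc τ₁ τ₂ := ⟨h₁'.le, h₂.le⟩
  have hle : τ₁ ≤ τ₂ := h₁'.le.trans h₂.le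
  rcases ContinuousOn.strictMonoOn_of_injOn_Icc' hle (hc.mono hsub) (hi.mono hsub) with h | h
  · refine mem_of_superset (Icc_mem_nhds (h (left_mem_Icc.2 hle) hτ' h₁')
      (h hτ' (right_mem_Icc.2 hle) h₂)) ?_
    exact (intermediate_value_Icc hle (hc.mono hsub)).trans (image_mono hsub)
  · refine mem_of_superset (Icc_mem_nhds (h hτ' (right_mem_Icc.2 hle) h₂)
      (h (left_mem_Icc.2 hle) hτ' h₁')) ?_
    exact (intermediate_value_Icc' hle (hc.mono hsub)).trans (image_mono hsub)

/-! ### The cuspidal integral curves of a chart. -/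

namespace CuspChart

variable {K : Configuration} (c : CuspChart K)

/-- The cuspidal integral curve through the discriminant point with coordinates `(0, s)`. -/
def curve (s t : ℝ) : ℝ × ℝ := c.chart.symm (t ^ 2, c.field.flow t s)

/-- The parameters at which the cuspidal integral curve lies in the chart. -/
def times (s : ℝ) : Set ℝ := {t | (t ^ 2, c.field.flow t s) ∈ c.chart.target}

theorem continuous_flow_left (s : ℝ) : Continuous fun t => c.field.flow t s :=
  c.field.continuous_sol 0 s

theorem isOpen_times (s : ℝ) : IsOpen (c.times s) :=
  c.chart.open_target.preimage ((continuous_id.pow 2).prodMk (c.continuous_flow_left s))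

theorem abs_lt_of_sq_eq {x : ℝ × ℝ} (hx : x ∈ c.chart.source) {t : ℝ} (ht : t ^ 2 = c.r x) :
    |t| < c.ε := by
  have h := c.target_fst _ (c.chart.map_source hx)
  rw [c.chart_apply x hx, ← ht, abs_of_nonneg (sq_nonneg t)] at h
  exact abs_lt_of_sq_lt_sq h c.ε_pos.le

variable {c}

theorem curve_mem {s t : ℝ} (ht : t ∈ c.times s) : c.curve s t ∈ c.chart.source :=
  c.chart.map_target ht

theorem chart_curve {s t : ℝ} (ht : t ∈ c.times s) :
    c.chart (c.curve s t) = (t ^ 2, c.field.flow t s) := c.chart.right_inv ht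

theorem r_curve {s t : ℝ} (ht : t ∈ c.times s) : c.r (c.curve s t) = t ^ 2 := by
  have h := chart_curve ht
  rw [c.chart_apply _ (curve_mem ht)] at h
  exact congrArg Prod.fst h

theorem curve_snd {s t : ℝ} (ht : t ∈ c.times s) : (c.curve s t).2 = c.field.flow t s := by
  have h := chart_curve ht
  rw [c.chart_apply _ (curve_mem ht)] at h
  exact congrArg Prod.snd h

theorem abs_lt_of_mem_times {s t : ℝ} (ht : t ∈ c.times s) : |t| < c.ε :=
  c.abs_lt_of_sq_eq (curve_mem ht) (r_curve ht).symm

/-- The truncated field is known to be smooth only in the ε-box, where solutions inherit its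
regularity; `times s` keeps the solution inside the box. -/
theorem contDiffAt_flow {s t : ℝ} (ht : t ∈ c.times s) :
    ContDiffAt ℝ ∞ (fun t => c.field.flow t s) t := by
  obtain ⟨δ, hδ, hT⟩ := Metric.isOpen_iff.1 (c.isOpen_times s) t ht
  rw [Real.ball_eq_Ioo] at hT
  have hsub : Icc (t - δ / 2) (t + δ / 2) ⊆ c.times s :=
    fun x hx => hT ⟨by linarith [hx.1], by linarith [hx.2]⟩
  have h := ODE.contDiffOn_enat_Icc_of_hasDerivWithinAt (n := ⊤) (f := c.G)
    (α := fun t => c.field.flow t s) (tmin := t - δ / 2) (tmax := t + δ / 2)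
    (u := Ioo (-c.ε) c.ε)
    (c.contDiffOn_field.mono (prod_mono (fun x hx => abs_lt.1 (abs_lt_of_mem_times (hsub hx)))
      Subset.rfl))
    (fun x _ => (c.field.hasDerivAt_flow x s).hasDerivWithinAt)
    (fun x hx => abs_lt.1 (c.target_snd _ (hsub hx)))
  exact h.contDiffAt (Icc_mem_nhds (by linarith) (by linarith))

theorem contDiffAt_curve {s t : ℝ} (ht : t ∈ c.times s) : ContDiffAt ℝ ∞ (c.curve s) t :=
  (c.contDiffAt_symm _ ht).comp t ((contDiffAt_id.pow 2).prodMk (contDiffAt_flow ht))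

theorem fderiv_apply_eq {r : ℝ × ℝ → ℝ} (x w : ℝ × ℝ) :
    fderiv ℝ r x w = fderiv ℝ r x (1, 0) * w.1 + fderiv ℝ r x (0, 1) * w.2 := by
  conv_lhs => rw [show w = w.1 • ((1 : ℝ), (0 : ℝ)) + w.2 • ((0 : ℝ), (1 : ℝ)) by ext <;> simp]
  rw [map_add, map_smul, map_smul, smul_eq_mul, smul_eq_mul, mul_comm, mul_comm w.2]

/-- The chart coordinates of the curve are t² and the flow, so its velocity solves a linear system
with r_u ≠ 0. The explicit factor t is the source of the cusp at t = 0. -/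
theorem deriv_curve {s t : ℝ} (ht : t ∈ c.times s) :
    deriv (c.curve s) t = t • ((2 / speed c.f c.r c.σ t (c.curve s t)) •
      ((1 : ℝ), c.σ * t - c.f (c.curve s t))) := by
  set x := c.curve s t with hx
  have hxs : x ∈ c.chart.source := curve_mem ht
  have hd : HasDerivAt (c.curve s) (deriv (c.curve s) t) t :=
    ((contDiffAt_curve ht).differentiableAt (by simp)).hasDerivAt
  set w := deriv (c.curve s) t
  have hev := (c.isOpen_times s).mem_nhds ht
  have h2 : w.2 = c.G t (c.field.flow t s) := by
    have h : HasDerivAt (fun t => (c.curve s t).2) w.2 t := hasDerivAt_comp_curve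
      (l := Prod.snd) (l' := ContinuousLinearMap.snd ℝ ℝ ℝ) hasFDerivAt_snd hd rfl
    refine h.unique ((c.field.hasDerivAt_flow t s).congr_of_eventuallyEq ?_)
    filter_upwards [hev] with τ hτ using curve_snd hτ
  have h1 : fderiv ℝ c.r x w = 2 * t := by
    have h := hasDerivAt_comp_curve
      ((c.contDiffAt_r x hxs).differentiableAt (by simp)).hasFDerivAt hd rfl
    have h' : HasDerivAt (fun τ : ℝ => τ ^ 2) (2 * t) t := by simpa using hasDerivAt_pow 2 t
    refine h.unique (h'.congr_of_eventuallyEq ?_)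
    filter_upwards [hev] with τ hτ using r_curve hτ
  have hr : t ^ 2 = c.r x := (r_curve ht).symm
  have hP := c.speed_ne x hxs t hr
  have hS := c.slope_mul x hxs t hr
  rw [show x.2 = c.field.flow t s from curve_snd ht] at hS
  rw [c.field_eq t _ (abs_lt_of_mem_times ht)] at h2
  have hu := c.fderiv_ne x hxs
  rw [fderiv_apply_eq] at h1
  set P := speed c.f c.r c.σ t x with hPdef
  have h2' : w.2 = 2 * t * (c.σ * t - c.f x) / P := by
    rw [h2, eq_div_iff hP, ← hS]
    ring
  have h1' : w.1 = 2 * t / P := by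
    rw [eq_div_iff hP]
    have e : fderiv ℝ c.r x (1, 0) * w.1 * P = 2 * t * fderiv ℝ c.r x (1, 0) := by
      have e1 : w.2 * P = 2 * t * (c.σ * t - c.f x) := by rw [h2']; field_simp
      have e2 : P = fderiv ℝ c.r x (1, 0) + fderiv ℝ c.r x (0, 1) * (c.σ * t - c.f x) := rfl
      linear_combination P * h1 - fderiv ℝ c.r x (0, 1) * e1 + 2 * t * e2
    have e3 : fderiv ℝ c.r x (1, 0) * (w.1 * P - 2 * t) = 0 := by linear_combination e
    rcases mul_eq_zero.1 e3 with h | h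
    · exact absurd h hu
    · linarith
  ext
  · simp only [Prod.smul_fst, smul_eq_mul, h1']
    ring
  · simp only [Prod.smul_snd, smul_eq_mul, h2']
    ring

theorem injOn_curve (s : ℝ) : InjOn (c.curve s) (c.times s) := by
  intro t ht t' ht' h
  have := congrArg c.chart h
  rw [chart_curve ht, chart_curve ht'] at this
  exact c.field.injective_sq_flow s this

theorem isCurve_image_curve {s : ℝ} {T : Set ℝ} (ho : IsOpen T) (hc : IsPreconnected T)
    (hne : T.Nonempty) (hT : T ⊆ c.times s) : K.IsCurve (c.curve s '' T) := by
  have hb : BddBelow T := ⟨-c.ε, fun t ht => (abs_lt.1 (abs_lt_of_mem_times (hT ht))).1.le⟩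
  have hb' : BddAbove T := ⟨c.ε, fun t ht => (abs_lt.1 (abs_lt_of_mem_times (hT ht))).2.le⟩
  obtain ⟨hlt, hE⟩ := hc.eq_Ioo_of_isOpen ho hne hb hb'
  refine ⟨sInf T, sSup T, c.curve s, hlt, ?_⟩
  rw [← hE]
  refine ⟨fun t ht => (contDiffAt_curve (hT ht)).contDiffWithinAt, (injOn_curve s).mono hT,
    fun t ht => c.source_subset (curve_mem (hT ht)), fun t ht => ?_, fun t ht h => ?_, rfl⟩
  · rw [c.dir_iff _ (curve_mem (hT ht)), deriv_curve (hT ht), r_curve (hT ht)]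
    simp only [Prod.smul_fst, Prod.smul_snd, smul_eq_mul]
    have := c.σ_mul
    linear_combination (t ^ 2 * (t * (2 / speed c.f c.r c.σ t (c.curve s t))) ^ 2) * this
  · rw [c.disc_iff _ (curve_mem (hT ht)), r_curve (hT ht)]
    rw [deriv_curve (hT ht)] at h
    have h1 := congrArg Prod.fst h
    have hP := c.speed_ne _ (curve_mem (hT ht)) t (r_curve (hT ht)).symm
    simp only [Prod.smul_fst, smul_eq_mul, Prod.fst_zero, mul_one, mul_eq_zero, div_eq_zero_iff,
      OfNat.ofNat_ne_zero, hP, or_self, or_false] at h1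
    simp [h1]

end CuspChart

/-! ### Integral curves in a chart are pieces of the cuspidal curves. -/

namespace CuspChart

variable {K : Configuration} (c : CuspChart K)

/-- An integral curve in the chart follows one of the cuspidal curves. -/
theorem exists_parameter {a b : ℝ} {γ : ℝ → ℝ × ℝ} (hab : a < b)
    (hγ : ContDiffOn ℝ ∞ γ (Ioo a b)) (hmem : ∀ τ ∈ Ioo a b, γ τ ∈ c.chart.source)
    (hdir : ∀ τ ∈ Ioo a b, K.dir (γ τ) (deriv γ τ))
    (hdisc : ∀ τ ∈ Ioo a b, deriv γ τ = 0 → γ τ ∈ K.disc) :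
    ∃ (s : ℝ) (t : ℝ → ℝ), ContinuousOn t (Ioo a b) ∧
      ∀ τ ∈ Ioo a b, c.chart (γ τ) = (t τ ^ 2, c.field.flow (t τ) s) := by
  have hI : ∀ τ ∈ Ioo a b, Ioo a b ∈ 𝓝 τ := fun τ hτ => isOpen_Ioo.mem_nhds hτ
  have hγ' : ∀ τ ∈ Ioo a b, ContDiffAt ℝ ∞ γ τ := fun τ hτ => hγ.contDiffAt (hI τ hτ)
  set w := deriv γ
  have hwd : ∀ τ ∈ Ioo a b, HasDerivAt γ (w τ) τ := fun τ hτ =>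
    ((hγ' τ hτ).differentiableAt (by simp)).hasDerivAt
  have hwc : ∀ τ ∈ Ioo a b, DifferentiableAt ℝ w τ := fun τ hτ =>
    ((hγ.deriv_of_isOpen (m := 1) isOpen_Ioo (by norm_cast)).contDiffAt
      (hI τ hτ)).differentiableAt (by simp)
  have hfd : ∀ τ ∈ Ioo a b, DifferentiableAt ℝ (fun τ => c.f (γ τ)) τ := fun τ hτ =>
    (hasDerivAt_comp_curve ((c.contDiffAt_f _ (hmem τ hτ)).differentiableAt
      (by simp)).hasFDerivAt (hwd τ hτ) rfl).differentiableAt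
  have h1 : ∀ τ ∈ Ioo a b,
      ((w τ).2 + c.f (γ τ) * (w τ).1) ^ 2 = c.r (γ τ) * (w τ).1 ^ 2 := fun τ hτ =>
    (c.dir_iff _ (hmem τ hτ) _).1 (hdir τ hτ)
  have h2 : ∀ τ ∈ Ioo a b, (w τ).1 = 0 → (w τ).2 = 0 ∧ c.r (γ τ) = 0 := by
    intro τ hτ h
    have h3 := h1 τ hτ
    rw [h] at h3
    have h4 : (w τ).2 = 0 := by simpa using h3
    exact ⟨h4, (c.disc_iff _ (hmem τ hτ)).1 (hdisc τ hτ (Prod.ext h h4))⟩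
  -- This lifts γ to the double cover. Where u' = 0, division by zero returns the correct value t =
  -- 0: the whole velocity vanishes there, so r = 0.
  set t : ℝ → ℝ := fun τ => c.σ * ((w τ).2 + c.f (γ τ) * (w τ).1) / (w τ).1 with ht
  have htr : ∀ τ ∈ Ioo a b, t τ ^ 2 = c.r (γ τ) := by
    intro τ hτ
    by_cases h : (w τ).1 = 0
    · simp [ht, h, (h2 τ hτ h).2]
    · have h3 := h1 τ hτ
      simp only [ht, div_pow, mul_pow]
      rw [h3, sq c.σ, c.σ_mul]
      field_simp
  have htw : ∀ τ ∈ Ioo a b, (w τ).2 = (c.σ * t τ - c.f (γ τ)) * (w τ).1 := by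
    intro τ hτ
    by_cases h : (w τ).1 = 0
    · simp [h, (h2 τ hτ h).1]
    · have h3 := c.σ_mul
      have h4 : t τ * (w τ).1 = c.σ * ((w τ).2 + c.f (γ τ) * (w τ).1) := by
        simp only [ht]
        field_simp
      linear_combination (-c.σ) * h4 - ((w τ).2 + c.f (γ τ) * (w τ).1) * h3
  have htd : ∀ τ ∈ Ioo a b, c.r (γ τ) ≠ 0 → DifferentiableAt ℝ t τ := by
    intro τ hτ h
    have hw1 := (hwc τ hτ).fst
    have hw2 := (hwc τ hτ).snd
    exact ((differentiableAt_const _).mul (hw2.add ((hfd τ hτ).mul hw1))).div hw1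
      fun h0 => h (h2 τ hτ h0).2
  set ρ : ℝ → ℝ := fun τ => speed c.f c.r c.σ (t τ) (γ τ) * (w τ).1 with hρ
  have hrd : ∀ τ ∈ Ioo a b, HasDerivAt (fun τ => c.r (γ τ)) (ρ τ) τ := by
    intro τ hτ
    refine (hasDerivAt_comp_curve ((c.contDiffAt_r _ (hmem τ hτ)).differentiableAt
      (by simp)).hasFDerivAt (hwd τ hτ) rfl).congr_deriv ?_
    rw [fderiv_apply_eq, htw τ hτ]
    simp only [hρ, speed]
    ring
  have hρc : ContinuousOn ρ (Ioo a b) := by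
    have hrs : ContDiffOn ℝ 1 (fun τ => c.r (γ τ)) (Ioo a b) := fun τ hτ =>
      (((c.contDiffAt_r _ (hmem τ hτ)).comp τ (hγ' τ hτ)).of_le (by simp)).contDiffWithinAt
    refine (hrs.continuousOn_deriv_of_isOpen isOpen_Ioo le_rfl).congr fun τ hτ => ?_
    exact (hrd τ hτ).deriv.symm
  -- Both v ∘ γ and the flow at time t(τ) will solve y' = slope(t, y) ρ with ρ = (r ∘ γ)'. Using ρ
  -- instead of t' matters, since t is not known to be differentiable where r = 0.
  have hvd : ∀ τ ∈ Ioo a b,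
      HasDerivAt (fun τ => (γ τ).2) (c.slope (t τ) (γ τ).2 * ρ τ) τ := by
    intro τ hτ
    have h : HasDerivAt (fun τ => (γ τ).2) (w τ).2 τ := hasDerivAt_comp_curve
      (l := Prod.snd) (l' := ContinuousLinearMap.snd ℝ ℝ ℝ) hasFDerivAt_snd (hwd τ hτ) rfl
    refine h.congr_deriv ?_
    rw [htw τ hτ, hρ]
    linear_combination (-(w τ).1) * c.slope_mul _ (hmem τ hτ) (t τ) (htr τ hτ)
  have htc : ContinuousOn t (Ioo a b) := by
    intro τ hτ
    refine ContinuousAt.continuousWithinAt ?_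
    by_cases h : c.r (γ τ) = 0
    · have ht0 : t τ = 0 := by
        have := htr τ hτ
        rw [h] at this
        simpa using this
      have h3 : Tendsto (fun τ => √(c.r (γ τ))) (𝓝 τ) (𝓝 0) := by
        have := (hrd τ hτ).continuousAt.sqrt
        rw [ContinuousAt, h, Real.sqrt_zero] at this
        exact this
      rw [ContinuousAt, ht0]
      refine squeeze_zero_norm' ?_ h3
      filter_upwards [hI τ hτ] with τ' hτ'
      rw [← htr τ' hτ', Real.sqrt_sq_eq_abs, Real.norm_eq_abs]
    · exact (htd τ hτ h).continuousAt
  obtain ⟨τ₀, hτ₀⟩ := exists_between hab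
  set s := c.field.initial (t τ₀) (γ τ₀).2 with hs
  have hyd : ∀ τ ∈ Ioo a b, HasDerivAt (fun τ => c.field.flow (t τ) s)
      (c.slope (t τ) (c.field.flow (t τ) s) * ρ τ) τ := by
    intro τ hτ
    by_cases h : c.r (γ τ) = 0
    · have ht0 : t τ = 0 := by
        have := htr τ hτ
        rw [h] at this
        simpa using this
      -- As r ∘ γ = t² ≥ 0, a zero is a minimum and ρ vanishes there. The flow differs from s by at
      -- most M t² = M (r ∘ γ), which is then of smaller order than the time increment.
      have hρ0 : ρ τ = 0 := by
        have hmin : IsLocalMin (fun τ => c.r (γ τ)) τ := by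
          filter_upwards [hI τ hτ] with τ' hτ'
          rw [h, ← htr τ' hτ']
          positivity
        exact hmin.hasDerivAt_eq_zero (hrd τ hτ)
      rw [hρ0, mul_zero, hasDerivAt_iff_isLittleO]
      have h3 := hrd τ hτ
      rw [hρ0, hasDerivAt_iff_isLittleO] at h3
      simp only [h, smul_zero, sub_zero, ht0, FoldField.flow_zero] at h3 ⊢
      refine Asymptotics.IsBigO.trans_isLittleO ?_ h3
      refine Asymptotics.IsBigO.of_bound c.M ?_
      filter_upwards [hI τ hτ] with τ' hτ'
      rw [← htr τ' hτ', Real.norm_eq_abs, Real.norm_eq_abs, abs_of_nonneg (sq_nonneg (t τ'))]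
      exact c.field.abs_flow_sub_le _ _
    · have htd' := (htd τ hτ h).hasDerivAt
      have h3 : 2 * t τ * deriv t τ = ρ τ := by
        have h4 : HasDerivAt (fun τ => t τ ^ 2) (2 * t τ * deriv t τ) τ := by
          exact (htd'.pow 2).congr_deriv (by simp)
        refine h4.unique ((hrd τ hτ).congr_of_eventuallyEq ?_)
        filter_upwards [hI τ hτ] with τ' hτ' using htr τ' hτ'
      refine (HasDerivAt.comp τ (c.field.hasDerivAt_flow (t τ) s) htd').congr_deriv ?_
      rw [c.field_eq _ _ (c.abs_lt_of_sq_eq (hmem τ hτ) (htr τ hτ)), ← h3]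
      ring
  refine ⟨s, t, htc, fun τ hτ => ?_⟩
  rw [c.chart_apply _ (hmem τ hτ), htr τ hτ]
  refine Prod.ext rfl ?_
  change (γ τ).2 = c.field.flow (t τ) s
  -- On a compact interval around τ and τ₀ the factor ρ is bounded, which makes the right-hand side
  -- uniformly Lipschitz in y.
  obtain ⟨a', ha, ha'⟩ := exists_between (lt_min hτ.1 hτ₀.1)
  obtain ⟨b', hb', hb⟩ := exists_between (max_lt hτ.2 hτ₀.2)
  have hsub : Icc a' b' ⊆ Ioo a b := fun x hx => ⟨ha.trans_le hx.1, hx.2.trans_lt hb⟩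
  obtain ⟨B, hB⟩ := isCompact_Icc.exists_bound_of_continuousOn (hρc.mono hsub)
  refine ODE_solution_unique_of_mem_Icc (K := c.C * B.toNNReal) (a := a') (b := b') (t₀ := τ₀)
    (f := fun τ => (γ τ).2) (g := fun τ => c.field.flow (t τ) s)
    (v := fun τ y => c.slope (t τ) y * ρ τ) (s := fun _ => univ) (fun x hx => ?_)
    ⟨ha'.trans_le (min_le_right _ _), (le_max_right _ _).trans_lt hb'⟩
    (HasDerivAt.continuousOn fun x hx => hvd x (hsub hx))
    (fun x hx => hvd x (hsub (Ioo_subset_Icc_self hx))) (fun _ _ => trivial)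
    (HasDerivAt.continuousOn fun x hx => hyd x (hsub hx))
    (fun x hx => hyd x (hsub (Ioo_subset_Icc_self hx))) (fun _ _ => trivial)
    (by simp [hs]) ⟨(ha'.trans_le (min_le_left _ _)).le, ((le_max_left _ _).trans_lt hb').le⟩
  refine (LipschitzWith.of_dist_le_mul fun y z => ?_).lipschitzOnWith
  have h3 := (c.slope_lipschitz (t x)).dist_le_mul y z
  have h4 := hB x (Ioo_subset_Icc_self hx)
  rw [Real.dist_eq, ← sub_mul, abs_mul]
  push_cast
  calc _ ≤ (c.C * dist y z) * B.toNNReal := by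
        refine mul_le_mul h3 (h4.trans (Real.le_coe_toNNReal B)) (abs_nonneg _) (by positivity)
    _ = _ := by ring

theorem exists_image_chart_of_isCurve {Γ : Set (ℝ × ℝ)} (hΓ : Γ ⊆ c.chart.source)
    (h : K.IsCurve Γ) : ∃ (s : ℝ) (T : Set ℝ), IsOpen T ∧ IsPreconnected T ∧ T.Nonempty ∧
      c.chart '' Γ = (fun t => (t ^ 2, c.field.flow t s)) '' T := by
  obtain ⟨a, b, γ, hab, hγ, hinj, -, hdir, hdisc, rfl⟩ := h
  have hmem : ∀ τ ∈ Ioo a b, γ τ ∈ c.chart.source := fun τ hτ => hΓ (mem_image_of_mem _ hτ)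
  obtain ⟨s, t, htc, ht⟩ := c.exists_parameter hab hγ hmem hdir hdisc
  refine ⟨s, t '' Ioo a b, isOpen_image_Ioo_of_injOn htc fun τ hτ τ' hτ' hE => ?_,
    isPreconnected_Ioo.image _ htc, (nonempty_Ioo.2 hab).image _, ?_⟩
  · refine hinj hτ hτ' (c.chart.injOn (hmem τ hτ) (hmem τ' hτ') ?_)
    rw [ht τ hτ, ht τ' hτ', hE]
  · rw [image_image, image_image]
    exact image_congr ht

theorem isCurve_of_image_chart {Γ : Set (ℝ × ℝ)} (hΓ : Γ ⊆ c.chart.source) {s : ℝ} {T : Set ℝ}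
    (hE : c.chart '' Γ = (fun t => (t ^ 2, c.field.flow t s)) '' T) :
    T ⊆ c.times s ∧ Γ = c.curve s '' T := by
  have hT : T ⊆ c.times s := by
    intro t ht
    have : (fun t => (t ^ 2, c.field.flow t s)) t ∈ c.chart '' Γ := hE ▸ mem_image_of_mem _ ht
    obtain ⟨x, hx, hx'⟩ := this
    have := c.chart.map_source (hΓ hx)
    rwa [hx'] at this
  refine ⟨hT, ?_⟩
  have h := congrArg (fun S => c.chart.symm '' S) hE
  simp only [image_image] at h
  rw [image_congr fun x hx => c.chart.left_inv (hΓ hx), image_id'] at h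
  exact h

/-- The homeomorphism straightening the cuspidal curves to broken lines. -/
def straighten : OpenPartialHomeomorph (ℝ × ℝ) (ℝ × ℝ) :=
  c.chart.trans (c.field.isOpenEmbedding_foldMap.toOpenPartialHomeomorph)

theorem straighten_source : c.straighten.source = c.chart.source := by
  simp [straighten]

theorem straighten_apply (x : ℝ × ℝ) : c.straighten x = c.field.foldMap (c.chart x) := rfl

/-- The criterion on the right no longer involves the differential equation; this is what allows two
configurations to be compared. -/
theorem isCurve_iff {Γ : Set (ℝ × ℝ)} (hΓ : Γ ⊆ c.chart.source) :
    K.IsCurve Γ ↔ IsBrokenArc (c.straighten '' Γ) := by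
  have hE : c.straighten '' Γ = c.field.foldMap '' (c.chart '' Γ) := by
    rw [image_image]
    rfl
  rw [hE, c.field.isBrokenArc_image_foldMap_iff]
  refine ⟨c.exists_image_chart_of_isCurve hΓ, ?_⟩
  rintro ⟨s, T, ho, hc, hne, h⟩
  obtain ⟨hT, rfl⟩ := c.isCurve_of_image_chart hΓ h
  exact isCurve_image_curve ho hc hne hT

theorem straighten_disc {x : ℝ × ℝ} (hx : x ∈ c.chart.source) :
    x ∈ K.disc ↔ (c.straighten x).1 = (c.straighten x).2 := by
  rw [c.disc_iff x hx, straighten_apply, c.field.foldMap_fst_eq_snd_iff, c.chart_apply x hx]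

theorem straighten_zero : c.straighten (0, 0) = (0, 0) := by
  rw [straighten_apply, c.chart_zero]
  simp [FoldField.foldMap]

end CuspChart

/-- One straightening followed by the inverse of the other: both fix the origin and have the same
model curves and the same diagonal as discriminant. Neither chart contains singular points. -/
theorem Configuration.IsCuspType.locallyTopEquiv {K K' : Configuration} (hK : K.IsCuspType)
    (hK' : K'.IsCuspType) : K.LocallyTopEquiv (0, 0) K' (0, 0) := by
  obtain ⟨c⟩ := hK.nonempty_cuspChart
  obtain ⟨c'⟩ := hK'.nonempty_cuspChart
  set H := c.straighten.trans c'.straighten.symm with hH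
  have h1 : ∀ x ∈ H.source, x ∈ c.chart.source := by
    intro x hx
    rw [← c.straighten_source]
    rw [hH, OpenPartialHomeomorph.trans_source] at hx
    exact hx.1
  have h2 : ∀ x ∈ H.source, c.straighten x ∈ c'.straighten.target := by
    intro x hx
    rw [hH, OpenPartialHomeomorph.trans_source] at hx
    exact hx.2
  have h3 : ∀ x ∈ H.source, H x ∈ c'.chart.source := by
    intro x hx
    rw [← c'.straighten_source]
    exact c'.straighten.map_target (h2 x hx)
  have h4 : ∀ x ∈ H.source, c'.straighten (H x) = c.straighten x := fun x hx =>
    c'.straighten.right_inv (h2 x hx)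
  have h0 : ((0, 0) : ℝ × ℝ) ∈ c'.straighten.target := by
    have : c'.straighten (0, 0) ∈ c'.straighten.target :=
      c'.straighten.map_source (c'.straighten_source ▸ c'.zero_mem)
    rwa [c'.straighten_zero] at this
  have h0s : ((0, 0) : ℝ × ℝ) ∈ H.source := by
    rw [hH, OpenPartialHomeomorph.trans_source]
    refine ⟨c.straighten_source ▸ c.zero_mem, ?_⟩
    rw [mem_preimage, c.straighten_zero]
    exact h0
  refine ⟨H, h0s, ?_, fun x hx => c.source_subset (h1 x hx), fun y hy => ?_, fun Γ hΓ => ?_,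
    fun x hx => ?_, fun x hx => ?_⟩
  · refine c'.straighten.injOn (c'.straighten_source ▸ h3 _ h0s)
      (c'.straighten_source ▸ c'.zero_mem) ?_
    rw [h4 _ h0s, c.straighten_zero, c'.straighten_zero]
  · have := h3 _ (H.map_target hy)
    rw [H.right_inv hy] at this
    exact c'.source_subset this
  · rw [c.isCurve_iff fun x hx => h1 x (hΓ hx), c'.isCurve_iff, image_image,
      image_congr fun x hx => h4 x (hΓ hx)]
    rintro _ ⟨x, hx, rfl⟩
    exact h3 x (hΓ hx)
  · rw [c.straighten_disc (h1 x hx), c'.straighten_disc (h3 x hx), h4 x hx]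
  · exact iff_of_false (c.notMem_sing x (h1 x hx)) (c'.notMem_sing _ (h3 x hx))

/-! ### Ordinary cusps along the discriminant curve. -/

theorem iteratedDeriv_of_deriv_eq_smul {E : Type*} [NormedAddCommGroup E] [NormedSpace ℝ E]
    {γ φ : ℝ → E} (hφ : ContDiffAt ℝ ∞ φ 0) (h : deriv γ =ᶠ[𝓝 0] fun t => t • φ t) :
    iteratedDeriv 2 γ 0 = φ 0 ∧ iteratedDeriv 3 γ 0 = (2 : ℝ) • deriv φ 0 := by
  have hφ2 : ContDiffAt ℝ 2 φ 0 := hφ.of_le (by norm_cast)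
  have hd : ∀ᶠ t in 𝓝 (0 : ℝ), DifferentiableAt ℝ φ t := by
    filter_upwards [hφ2.eventually (by simp)] with t ht using ht.differentiableAt (by simp)
  have h2 : deriv (deriv γ) =ᶠ[𝓝 0] fun t => t • deriv φ t + φ t := by
    refine h.deriv.trans ?_
    filter_upwards [hd] with t ht
    exact (((hasDerivAt_id t).smul ht.hasDerivAt).congr_deriv (by simp)).deriv
  have hdd : DifferentiableAt ℝ (fun t => fderiv ℝ φ t 1) 0 :=
    (((hφ2.fderiv_right (m := 1) (by norm_num)).clm_apply contDiffAt_const).differentiableAt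
      (by simp))
  simp only [fderiv_apply_one_eq_deriv] at hdd
  refine ⟨?_, ?_⟩
  · rw [iteratedDeriv_succ, iteratedDeriv_one, h2.self_of_nhds]
    simp
  · rw [iteratedDeriv_succ, iteratedDeriv_succ, iteratedDeriv_one, h2.deriv_eq]
    have := ((hasDerivAt_id (0 : ℝ)).smul hdd.hasDerivAt).add hd.self_of_nhds.hasDerivAt
    refine (this.congr_deriv ?_).deriv
    simp [two_smul]

namespace CuspChart

variable {K : Configuration} {c : CuspChart K}

/-- The velocity is t φ with φ = (2/P)(1, ψ) and ψ = σ t − f. The curve is stationary at t = 0, so f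
contributes nothing to ψ'(0) = σ ≠ 0, and φ'(0) is not parallel to φ(0). -/
theorem linearIndependent_curve {s : ℝ} (h0 : (0 : ℝ) ∈ c.times s) :
    LinearIndependent ℝ ![iteratedDeriv 2 (c.curve s) 0, iteratedDeriv 3 (c.curve s) 0] := by
  set P : ℝ → ℝ := fun t => speed c.f c.r c.σ t (c.curve s t) with hPdef
  set ψ : ℝ → ℝ := fun t => c.σ * t - c.f (c.curve s t) with hψdef
  have hx := curve_mem h0
  have hγ := contDiffAt_curve h0
  have hγ0 : HasDerivAt (c.curve s) 0 0 := by
    have := (hγ.differentiableAt (by simp)).hasDerivAt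
    rwa [deriv_curve h0, zero_smul] at this
  have hψ : ContDiffAt ℝ ∞ ψ 0 :=
    (contDiffAt_const.mul contDiffAt_id).sub ((c.contDiffAt_f _ hx).comp 0 hγ)
  have hψ0 : HasDerivAt ψ c.σ 0 := by
    have h1 := hasDerivAt_comp_curve
      ((c.contDiffAt_f _ hx).differentiableAt (by simp)).hasFDerivAt hγ0 rfl
    exact (((hasDerivAt_id (0 : ℝ)).const_mul c.σ).sub h1).congr_deriv (by simp)
  have hP : ContDiffAt ℝ ∞ P 0 := by
    have h1 : ContDiffAt ℝ ∞ (fun t => fderiv ℝ c.r (c.curve s t)) 0 :=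
      ((c.contDiffAt_r _ hx).fderiv_right (m := ∞) (by simp)).comp 0 hγ
    exact (h1.clm_apply contDiffAt_const).add ((h1.clm_apply contDiffAt_const).mul hψ)
  have hP0 : P 0 ≠ 0 := c.speed_ne _ hx 0 (r_curve h0).symm
  have hg : ContDiffAt ℝ ∞ (fun t => 2 / P t) 0 := contDiffAt_const.div hP hP0
  set g : ℝ → ℝ := fun t => 2 / P t
  have hg0 : g 0 ≠ 0 := div_ne_zero two_ne_zero hP0
  have hφ : ContDiffAt ℝ ∞ (fun t => g t • ((1 : ℝ), ψ t)) 0 :=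
    hg.smul (contDiffAt_const.prodMk hψ)
  obtain ⟨h2, h3⟩ := iteratedDeriv_of_deriv_eq_smul hφ (by
    filter_upwards [(c.isOpen_times s).mem_nhds h0] with t ht using deriv_curve ht)
  have hd : deriv (fun t => g t • ((1 : ℝ), ψ t)) 0 =
      (deriv g 0, g 0 * c.σ + deriv g 0 * ψ 0) := by
    have := (hg.differentiableAt (by simp)).hasDerivAt.smul
      ((hasDerivAt_const (0 : ℝ) (1 : ℝ)).prodMk hψ0)
    exact (this.congr_deriv (by ext <;> simp)).deriv
  have hσ : c.σ ≠ 0 := fun h => by simpa [h] using c.σ_mul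
  rw [h2, h3, hd, LinearIndependent.pair_iff]
  intro p q hpq
  have e1 := congrArg Prod.fst hpq
  have e2 := congrArg Prod.snd hpq
  simp only [Prod.fst_add, Prod.snd_add, Prod.smul_fst, Prod.smul_snd, smul_eq_mul,
    Prod.fst_zero, Prod.snd_zero, mul_one] at e1 e2
  have hq : q * (2 * (g 0 * c.σ)) = 0 := by linear_combination e2 - ψ 0 * e1
  have hq0 : q = 0 := (mul_eq_zero.1 hq).resolve_right
    (mul_ne_zero two_ne_zero (mul_ne_zero hg0 hσ))
  refine ⟨?_, hq0⟩
  rw [hq0, zero_mul, add_zero] at e1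
  exact (mul_eq_zero.1 e1).resolve_right hg0

theorem hasOrdinaryCuspAt {Γ : Set (ℝ × ℝ)} (hΓ : Γ ⊆ c.chart.source) (h : K.IsCurve Γ)
    {x : ℝ × ℝ} (hx : x ∈ Γ) (hd : x ∈ K.disc) : HasOrdinaryCuspAt Γ x := by
  obtain ⟨s, T, ho, -, -, hE⟩ := c.exists_image_chart_of_isCurve hΓ h
  obtain ⟨hT, rfl⟩ := c.isCurve_of_image_chart hΓ hE
  obtain ⟨t, ht, rfl⟩ := hx
  have ht0 : t = 0 := by
    have := (c.disc_iff _ (curve_mem (hT ht))).1 hd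
    rw [r_curve (hT ht)] at this
    simpa using this
  subst ht0
  obtain ⟨δ, hδ, hδT⟩ := Metric.isOpen_iff.1 ho 0 ht
  rw [Real.ball_eq_Ioo, zero_sub, zero_add] at hδT
  refine ⟨δ, c.curve s, hδ, fun t h => (contDiffAt_curve (hT (hδT h))).contDiffWithinAt, rfl, ?_,
    linearIndependent_curve (hT ht), image_mono hδT, fun ρ hρ hρδ => ?_⟩
  · rw [deriv_curve (hT ht), zero_smul]
  · have hrc := (c.contDiffAt_r _ (curve_mem (hT ht))).continuousAt
    -- Since r = t² on the curve, the points of Γ with r < ρ² have |t| < ρ: Γ does not come back to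
    -- the cusp along another part.
    have h0 : c.r (c.curve s 0) < ρ ^ 2 := by
      rw [r_curve (hT ht), zero_pow two_ne_zero]
      positivity
    filter_upwards [nhdsWithin_le_nhds (hrc.eventually (gt_mem_nhds h0)),
      self_mem_nhdsWithin] with y hy hyΓ
    obtain ⟨t, ht, rfl⟩ := hyΓ
    rw [r_curve (hT ht)] at hy
    exact ⟨t, abs_lt.1 (abs_lt_of_sq_lt_sq hy hρ.le), rfl⟩

end CuspChart

theorem Configuration.IsCuspType.cuspsAlongDiscriminant {K : Configuration} (hK : K.IsCuspType) :
    K.CuspsAlongDiscriminant (0, 0) := by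
  obtain ⟨c⟩ := hK.nonempty_cuspChart
  refine ⟨c.chart.source, c.chart.open_source.mem_nhds c.zero_mem, fun x hx hd => ⟨?_, ?_⟩⟩
  · have hc : c.chart x = ((0 : ℝ) ^ 2, c.field.flow 0 x.2) := by
      rw [c.chart_apply x hx, (c.disc_iff x hx).1 hd]
      simp
    have h0 : (0 : ℝ) ∈ c.times x.2 := by
      have := c.chart.map_source hx
      rwa [hc] at this
    obtain ⟨δ, hδ, hδT⟩ := Metric.isOpen_iff.1 (c.isOpen_times x.2) 0 h0
    refine ⟨c.curve x.2 '' Metric.ball 0 δ, ?_, CuspChart.isCurve_image_curve Metric.isOpen_ball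
      (convex_ball 0 δ).isPreconnected ⟨0, Metric.mem_ball_self hδ⟩ hδT,
      0, Metric.mem_ball_self hδ, ?_⟩
    · rintro _ ⟨t, ht, rfl⟩
      exact CuspChart.curve_mem (hδT ht)
    · rw [CuspChart.curve, ← hc, c.chart.left_inv hx]
  · exact fun Γ hΓ hcurve hxΓ => CuspChart.hasOrdinaryCuspAt hΓ hcurve hxΓ hd

/-- The configuration of a binary differential equation whose discriminant is transverse to
the double direction `dv = 0` is of cusp type. -/
theorem Configuration.isCuspType_of_quadratic {K : Configuration} {a b d : ℝ × ℝ → ℝ}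
    {N : Set (ℝ × ℝ)} (hN : IsOpen N) (h0N : (0, 0) ∈ N) (hND : N ⊆ K.domain)
    (ha : ContDiffOn ℝ ∞ a N) (hb : ContDiffOn ℝ ∞ b N) (hd : ContDiffOn ℝ ∞ d N)
    (ha0 : a (0, 0) = 0) (hb0 : b (0, 0) = 0) (hd0 : d (0, 0) ≠ 0)
    (hau : fderiv ℝ a (0, 0) (1, 0) ≠ 0)
    (hdir : ∀ x ∈ N, ∀ w : ℝ × ℝ,
      K.dir x w ↔ a x * w.1 ^ 2 + b x * w.1 * w.2 + d x * w.2 ^ 2 = 0)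
    (hdisc : ∀ x ∈ N, x ∈ K.disc ↔ b x ^ 2 - 4 * a x * d x = 0)
    (hsing : ∀ x ∈ N, x ∈ K.sing → d x = 0) : K.IsCuspType := by
  have hO : IsOpen (N ∩ d ⁻¹' {0}ᶜ) := hd.continuousOn.isOpen_inter_preimage hN
    isOpen_compl_singleton
  have hsub : N ∩ d ⁻¹' {0}ᶜ ⊆ N := inter_subset_left
  have hne : ∀ x ∈ N ∩ d ⁻¹' {0}ᶜ, d x ≠ 0 := fun x hx => hx.2
  have hne' : ∀ x ∈ N ∩ d ⁻¹' {0}ᶜ, 2 * d x ≠ 0 := fun x hx => mul_ne_zero two_ne_zero hx.2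
  have hf : ContDiffOn ℝ ∞ (fun x => b x / (2 * d x)) (N ∩ d ⁻¹' {0}ᶜ) :=
    (hb.mono hsub).div (contDiffOn_const.mul (hd.mono hsub)) hne'
  refine ⟨fun x => b x / (2 * d x), fun x => (b x / (2 * d x)) ^ 2 - a x / d x, _, hO, ⟨h0N, hd0⟩,
    hsub.trans hND, hf, (hf.pow 2).sub ((ha.mono hsub).div (hd.mono hsub) hne), by simp [hb0],
    by simp [hb0, ha0], ?_, fun x hx w => ?_, fun x hx => ?_, fun x hx h => hne x hx (hsing x hx.1 h)⟩
  · have hnb : N ∈ 𝓝 ((0, 0) : ℝ × ℝ) := hN.mem_nhds h0N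
    have h1 : HasFDerivAt a _ (0, 0) := ((ha.contDiffAt hnb).differentiableAt (by simp)).hasFDerivAt
    have h2 : DifferentiableAt ℝ (fun x => (d x)⁻¹) (0, 0) :=
      ((hd.contDiffAt hnb).differentiableAt (by simp)).inv hd0
    have h3 : DifferentiableAt ℝ (fun x => b x / (2 * d x)) (0, 0) :=
      (hf.contDiffAt (hO.mem_nhds ⟨h0N, hd0⟩)).differentiableAt (by simp)
    -- Because a and b vanish at the origin, the u-derivative of r there is −a_u/d.
    have h4 := (h3.hasFDerivAt.pow 2).sub (h1.mul h2.hasFDerivAt)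
    have h5 : fderiv ℝ (fun x => (b x / (2 * d x)) ^ 2 - a x / d x) (0, 0) = _ :=
      HasFDerivAt.fderiv (h4.congr_of_eventuallyEq (.of_forall fun x => by
        simp [div_eq_mul_inv]))
    rw [h5]
    simp [hb0, ha0, hau, hd0]
  · have := hne x hx
    rw [hdir x hx.1]
    constructor
    · intro h
      field_simp
      linear_combination 4 * d x * h
    · intro h
      field_simp at h
      have h' : 4 * d x * (a x * w.1 ^ 2 + b x * w.1 * w.2 + d x * w.2 ^ 2) = 0 := by
        linear_combination h
      exact (mul_eq_zero.1 h').resolve_left (by simpa using this)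
  · have := hne x hx
    rw [hdisc x hx.1]
    constructor
    · intro h
      field_simp
      linear_combination h
    · intro h
      field_simp at h
      linear_combination h

theorem isCuspType_cuspBDE : (cuspBDE.configuration univ).IsCuspType := by
  refine Configuration.isCuspType_of_quadratic (a := cuspBDE.a) (b := cuspBDE.b) (d := cuspBDE.c)
    isOpen_univ (mem_univ _) Subset.rfl contDiff_fst.contDiffOn contDiff_const.contDiffOn
    contDiff_const.contDiffOn rfl rfl one_ne_zero ?_ (fun x _ w => Iff.rfl)
    (fun x _ => by simp [BDE.configuration]) (fun x _ h => h.2.2.2)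
  have : fderiv ℝ cuspBDE.a (0, 0) = ContinuousLinearMap.fst ℝ ℝ ℝ :=
    (hasFDerivAt_fst (𝕜 := ℝ) (p := ((0, 0) : ℝ × ℝ))).fderiv
  rw [this]
  simp

/-! ### Partial derivatives -/

/-- `f` is differentiable at `x` with partial derivatives `p` and `q`. -/
def HasPartials (f : ℝ × ℝ → ℝ) (p q : ℝ) (x : ℝ × ℝ) : Prop :=
  HasFDerivAt f (p • ContinuousLinearMap.fst ℝ ℝ ℝ + q • ContinuousLinearMap.snd ℝ ℝ ℝ) x

namespace HasPartials

variable {f g : ℝ × ℝ → ℝ} {p q p' q' : ℝ} {x : ℝ × ℝ}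

theorem pu_eq (h : HasPartials f p q x) : pu f x = p := by
  rw [pu, h.fderiv]
  simp

theorem pv_eq (h : HasPartials f p q x) : pv f x = q := by
  rw [pv, h.fderiv]
  simp

theorem fderiv_eq (h : HasPartials f p q x) (w : ℝ × ℝ) : fderiv ℝ f x w = p * w.1 + q * w.2 := by
  rw [h.fderiv]
  simp

theorem congr (h : HasPartials f p q x) (hp : p = p') (hq : q = q') : HasPartials f p' q' x := by
  rwa [← hp, ← hq]

theorem congr_of_eventuallyEq (h : HasPartials f p q x) (hg : g =ᶠ[𝓝 x] f) :
    HasPartials g p q x :=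
  HasFDerivAt.congr_of_eventuallyEq h hg

theorem const (c : ℝ) (x : ℝ × ℝ) : HasPartials (fun _ => c) 0 0 x :=
  (hasFDerivAt_const c x).congr_fderiv (by ext <;> simp)

theorem fst (x : ℝ × ℝ) : HasPartials (fun y => y.1) 1 0 x :=
  hasFDerivAt_fst.congr_fderiv (by ext <;> simp)

theorem snd (x : ℝ × ℝ) : HasPartials (fun y => y.2) 0 1 x :=
  hasFDerivAt_snd.congr_fderiv (by ext <;> simp)

theorem add (h : HasPartials f p q x) (h' : HasPartials g p' q' x) :
    HasPartials (fun y => f y + g y) (p + p') (q + q') x :=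
  (HasFDerivAt.add h h').congr_fderiv (by ext <;> simp)

theorem sub (h : HasPartials f p q x) (h' : HasPartials g p' q' x) :
    HasPartials (fun y => f y - g y) (p - p') (q - q') x :=
  (HasFDerivAt.sub h h').congr_fderiv (by ext <;> simp)

theorem neg (h : HasPartials f p q x) : HasPartials (fun y => -f y) (-p) (-q) x :=
  (HasFDerivAt.neg h).congr_fderiv (by ext <;> simp)

theorem mul (h : HasPartials f p q x) (h' : HasPartials g p' q' x) :
    HasPartials (fun y => f y * g y) (p * g x + f x * p') (q * g x + f x * q') x :=
  (HasFDerivAt.mul h h').congr_fderiv (by ext <;> simp <;> ring)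

theorem comp {φ : ℝ → ℝ} {c : ℝ} (hφ : HasDerivAt φ c (f x)) (h : HasPartials f p q x) :
    HasPartials (fun y => φ (f y)) (c * p) (c * q) x :=
  (hφ.comp_hasFDerivAt x h).congr_fderiv (by ext <;> simp)

end HasPartials

section Smooth

variable {E : Type*} [NormedAddCommGroup E] [NormedSpace ℝ E] {f g : ℝ × ℝ → E}
  {U : Set (ℝ × ℝ)} {x : ℝ × ℝ}

theorem contDiffOn_pu (hU : IsOpen U) (hf : ContDiffOn ℝ ∞ f U) : ContDiffOn ℝ ∞ (pu f) U :=
  (hf.fderiv_of_isOpen hU (by simp)).clm_apply contDiffOn_const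

theorem contDiffOn_pv (hU : IsOpen U) (hf : ContDiffOn ℝ ∞ f U) : ContDiffOn ℝ ∞ (pv f) U :=
  (hf.fderiv_of_isOpen hU (by simp)).clm_apply contDiffOn_const

theorem pu_congr (hU : IsOpen U) (hx : x ∈ U) (h : EqOn f g U) : pu f x = pu g x := by
  rw [pu, pu, (h.eventuallyEq_of_mem (hU.mem_nhds hx)).fderiv_eq]

theorem pv_congr (hU : IsOpen U) (hx : x ∈ U) (h : EqOn f g U) : pv f x = pv g x := by
  rw [pv, pv, (h.eventuallyEq_of_mem (hU.mem_nhds hx)).fderiv_eq]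

theorem pv_pu_comm (hU : IsOpen U) (hf : ContDiffOn ℝ ∞ f U) (hx : x ∈ U) :
    pv (pu f) x = pu (pv f) x := by
  have hf' := hf.contDiffAt (hU.mem_nhds hx)
  have hd : DifferentiableAt ℝ (fderiv ℝ f) x :=
    (hf'.fderiv_right (m := 1) (by norm_cast)).differentiableAt (by simp)
  have hs : IsSymmSndFDerivAt ℝ f x := hf'.isSymmSndFDerivAt (by simp; norm_cast)
  have key : ∀ w w' : ℝ × ℝ,
      fderiv ℝ (fun y => fderiv ℝ f y w) x w' = fderiv ℝ (fderiv ℝ f) x w' w := by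
    intro w w'
    rw [fderiv_clm_apply hd (differentiableAt_const w)]
    simp
  change fderiv ℝ (fun y => fderiv ℝ f y (1, 0)) x (0, 1) =
    fderiv ℝ (fun y => fderiv ℝ f y (0, 1)) x (1, 0)
  rw [key, key]
  exact hs _ _

end Smooth

section Scalar

variable {f : ℝ × ℝ → ℝ} {U : Set (ℝ × ℝ)} {x : ℝ × ℝ}

theorem hasPartials_of_differentiableAt (hf : DifferentiableAt ℝ f x) :
    HasPartials f (pu f x) (pv f x) x :=
  hf.hasFDerivAt.congr_fderiv (by ext <;> simp [pu, pv])

theorem hasPartials_of_contDiffOn (hU : IsOpen U) (hf : ContDiffOn ℝ ∞ f U) (hx : x ∈ U) :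
    HasPartials f (pu f x) (pv f x) x :=
  hasPartials_of_differentiableAt ((hf.contDiffAt (hU.mem_nhds hx)).differentiableAt (by simp))

/-- The mixed partial derivative `∂ᵢ₊ⱼ h / ∂uⁱ ∂vʲ`. -/
def mixed (h : ℝ × ℝ → ℝ) (i j : ℕ) : ℝ × ℝ → ℝ := pu^[i] (pv^[j] h)

theorem contDiffOn_mixed (hU : IsOpen U) (hf : ContDiffOn ℝ ∞ f U) (i j : ℕ) :
    ContDiffOn ℝ ∞ (mixed f i j) U := by
  have hj : ContDiffOn ℝ ∞ (pv^[j] f) U := by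
    induction j with
    | zero => exact hf
    | succ j ih =>
      rw [iterate_succ_apply']
      exact contDiffOn_pv hU ih
  induction i with
  | zero => exact hj
  | succ i ih =>
    rw [mixed, iterate_succ_apply']
    exact contDiffOn_pu hU ih

theorem pu_mixed (f : ℝ × ℝ → ℝ) (i j : ℕ) : pu (mixed f i j) = mixed f (i + 1) j := by
  rw [mixed, mixed, iterate_succ_apply']

/-- `mixed` takes the v-derivatives first, so a further v-derivative must be moved past the
u-derivatives by symmetry of second derivatives. -/
theorem pv_mixed (hU : IsOpen U) (hf : ContDiffOn ℝ ∞ f U) (i j : ℕ) :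
    EqOn (pv (mixed f i j)) (mixed f i (j + 1)) U := by
  induction i with
  | zero =>
    intro x _
    rw [mixed, mixed, iterate_zero_apply, iterate_zero_apply, iterate_succ_apply']
  | succ i ih =>
    intro x hx
    rw [← pu_mixed, ← pu_mixed, pv_pu_comm hU (contDiffOn_mixed hU hf i j) hx]
    exact pu_congr hU hx ih

theorem hasPartials_mixed (hU : IsOpen U) (hf : ContDiffOn ℝ ∞ f U) (hx : x ∈ U) (i j : ℕ) :
    HasPartials (mixed f i j) (mixed f (i + 1) j x) (mixed f i (j + 1) x) x :=
  (hasPartials_of_contDiffOn hU (contDiffOn_mixed hU hf i j) hx).congr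
    (by rw [pu_mixed]) (pv_mixed hU hf i j hx)

end Scalar

section Vector

variable {a b d : ℝ × ℝ → ℝ} {pa qa pb qb pd qd : ℝ} {x : ℝ × ℝ}

theorem fderiv_vec3 {F : ℝ × ℝ → Fin 3 → ℝ} (hF : F =ᶠ[𝓝 x] fun y => ![a y, b y, d y])
    (ha : HasPartials a pa qa x) (hb : HasPartials b pb qb x) (hd : HasPartials d pd qd x)
    (w : ℝ × ℝ) : fderiv ℝ F x w =
      ![pa * w.1 + qa * w.2, pb * w.1 + qb * w.2, pd * w.1 + qd * w.2] := by
  have h : HasFDerivAt (fun y => ![a y, b y, d y]) (ContinuousLinearMap.pi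
      ![pa • ContinuousLinearMap.fst ℝ ℝ ℝ + qa • ContinuousLinearMap.snd ℝ ℝ ℝ,
        pb • ContinuousLinearMap.fst ℝ ℝ ℝ + qb • ContinuousLinearMap.snd ℝ ℝ ℝ,
        pd • ContinuousLinearMap.fst ℝ ℝ ℝ + qd • ContinuousLinearMap.snd ℝ ℝ ℝ]) x := by
    rw [hasFDerivAt_pi']
    intro i
    fin_cases i
    · exact ha
    · exact hb
    · exact hd
  rw [hF.fderiv_eq, h.fderiv]
  ext i
  fin_cases i <;> simp

theorem pu_vec3 {F : ℝ × ℝ → Fin 3 → ℝ} (hF : F =ᶠ[𝓝 x] fun y => ![a y, b y, d y])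
    (ha : HasPartials a pa qa x) (hb : HasPartials b pb qb x) (hd : HasPartials d pd qd x) :
    pu F x = ![pa, pb, pd] := by
  rw [pu, fderiv_vec3 hF ha hb hd]
  simp

theorem pv_vec3 {F : ℝ × ℝ → Fin 3 → ℝ} (hF : F =ᶠ[𝓝 x] fun y => ![a y, b y, d y])
    (ha : HasPartials a pa qa x) (hb : HasPartials b pb qb x) (hd : HasPartials d pd qd x) :
    pv F x = ![qa, qb, qd] := by
  rw [pv, fderiv_vec3 hF ha hb hd]
  simp

end Vector

/-- A binary quadratic form has a unique root line, or vanishes, iff its discriminant is zero. -/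
theorem discriminant_eq_zero_iff (a b d : ℝ) :
    ((∃ w : ℝ × ℝ, w ≠ 0 ∧ ∀ w' : ℝ × ℝ,
        a * w'.1 ^ 2 + b * w'.1 * w'.2 + d * w'.2 ^ 2 = 0 ↔ ∃ c : ℝ, w' = c • w) ∨
      (a = 0 ∧ b = 0 ∧ d = 0)) ↔ b ^ 2 - 4 * a * d = 0 := by
  constructor
  · rintro (⟨⟨w₁, w₂⟩, hw, h⟩ | ⟨rfl, rfl, rfl⟩)
    · have hr := (h (w₁, w₂)).2 ⟨1, (one_smul ℝ _).symm⟩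
      simp only at hr
      -- g is the gradient of the form at the root w, orthogonal to w by Euler's identity. If g = 0,
      -- the matrix of the form kills w ≠ 0 and its determinant vanishes.
      set g₁ := 2 * a * w₁ + b * w₂ with hg₁
      set g₂ := b * w₁ + 2 * d * w₂ with hg₂
      have hort : g₁ * w₁ + g₂ * w₂ = 0 := by rw [hg₁, hg₂]; linear_combination 2 * hr
      by_cases hg : g₁ ^ 2 + g₂ ^ 2 = 0
      · have e1 : g₁ = 0 := by nlinarith [sq_nonneg g₁, sq_nonneg g₂]
        have e2 : g₂ = 0 := by nlinarith [sq_nonneg g₁, sq_nonneg g₂]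
        have f1 : (b ^ 2 - 4 * a * d) * w₁ = 0 := by
          linear_combination b * e2 - 2 * d * e1 + 2 * d * hg₁ - b * hg₂
        have f2 : (b ^ 2 - 4 * a * d) * w₂ = 0 := by
          linear_combination b * e1 - 2 * a * e2 + 2 * a * hg₂ - b * hg₁
        by_contra hne
        exact hw (Prod.ext ((mul_eq_zero.1 f1).resolve_left hne)
          ((mul_eq_zero.1 f2).resolve_left hne))
      · exfalso
        -- The form takes the value form(g) + t |g|² at g + t w, so this t gives a root. By
        -- uniqueness g is then parallel to w, yet it is orthogonal to w and nonzero.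
        set t := -(a * g₁ ^ 2 + b * g₁ * g₂ + d * g₂ ^ 2) / (g₁ ^ 2 + g₂ ^ 2) with ht
        have ht' : t * (g₁ ^ 2 + g₂ ^ 2) = -(a * g₁ ^ 2 + b * g₁ * g₂ + d * g₂ ^ 2) := by
          rw [ht]
          field_simp
        obtain ⟨c, hc⟩ := (h (g₁ + t * w₁, g₂ + t * w₂)).1 (by
          simp only
          linear_combination ht' + t ^ 2 * hr - t * g₁ * hg₁ - t * g₂ * hg₂)
        have c1 := congrArg Prod.fst hc
        have c2 := congrArg Prod.snd hc
        simp only [Prod.smul_fst, Prod.smul_snd, smul_eq_mul] at c1 c2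
        exact hg (by linear_combination g₁ * c1 + g₂ * c2 + (c - t) * hort)
    · ring
  · intro h
    by_cases ha : a = 0
    · subst ha
      have hb : b = 0 := by simpa using h
      subst hb
      by_cases hd : d = 0
      · exact .inr ⟨rfl, rfl, hd⟩
      · refine .inl ⟨(1, 0), by simp, fun w' => ?_⟩
        simp only [zero_mul, zero_add, mul_eq_zero, hd, false_or, ne_eq, OfNat.ofNat_ne_zero,
          not_false_eq_true, pow_eq_zero_iff]
        constructor
        · intro hw
          exact ⟨w'.1, by ext <;> simp [hw]⟩
        · rintro ⟨c, rfl⟩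
          simp
    · refine .inl ⟨(-b, 2 * a), by simp [ha], fun w' => ?_⟩
      constructor
      · intro hw
        have h1 : (2 * a * w'.1 + b * w'.2) ^ 2 = 0 := by
          linear_combination 4 * a * hw + w'.2 ^ 2 * h
        have h2 : 2 * a * w'.1 + b * w'.2 = 0 := by simpa using h1
        refine ⟨w'.2 / (2 * a), ?_⟩
        ext
        · simp only [Prod.smul_fst, smul_eq_mul]
          field_simp
          linear_combination h2
        · simp only [Prod.smul_snd, smul_eq_mul]
          field_simp
      · rintro ⟨c, rfl⟩
        simp only [Prod.smul_fst, Prod.smul_snd, smul_eq_mul]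
        linear_combination (-(c ^ 2 * a)) * h

/-! ### The affine normal of a Monge chart -/

section Monge

variable (h : ℝ × ℝ → ℝ)

/-- `h_uv² - h_uu h_vv`, positive at hyperbolic points. -/
def negHess (x : ℝ × ℝ) : ℝ := mixed h 1 1 x * mixed h 1 1 x - mixed h 2 0 x * mixed h 0 2 x

def negHessU (x : ℝ × ℝ) : ℝ :=
  2 * (mixed h 1 1 x * mixed h 2 1 x) - mixed h 3 0 x * mixed h 0 2 x
    - mixed h 2 0 x * mixed h 1 2 x

def negHessV (x : ℝ × ℝ) : ℝ :=
  2 * (mixed h 1 1 x * mixed h 1 2 x) - mixed h 2 1 x * mixed h 0 2 x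
    - mixed h 2 0 x * mixed h 0 3 x

/-- The affine distance factor `|LN - M²|^(1/4)`. -/
def quartic (x : ℝ × ℝ) : ℝ := negHess h x ^ (1 / 4 : ℝ)

/-- With δ = `negHess`, Cramer's rule for Hessian · (a, b) = −∇ρ divides by −δ, and ρ_u = ρ δ_u/(4δ)
supplies the rest. This isolates the only factor that is not polynomial in the derivatives of h. -/
def normalScale (x : ℝ × ℝ) : ℝ := quartic h x / (4 * negHess h x ^ 2)

def numU (x : ℝ × ℝ) : ℝ := negHessU h x * mixed h 0 2 x - negHessV h x * mixed h 1 1 x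

def numV (x : ℝ × ℝ) : ℝ := negHessV h x * mixed h 2 0 x - negHessU h x * mixed h 1 1 x

/-- The `u`-coordinate of the affine normal. -/
def normalU (x : ℝ × ℝ) : ℝ := normalScale h x * numU h x

/-- The `v`-coordinate of the affine normal. -/
def normalV (x : ℝ × ℝ) : ℝ := normalScale h x * numV h x

/-- The hyperbolic points of `U`. -/
def hyperbolicSet (U : Set (ℝ × ℝ)) : Set (ℝ × ℝ) := {x | x ∈ U ∧ 0 < negHess h x}

variable {h} {U : Set (ℝ × ℝ)} {x : ℝ × ℝ}

theorem contDiffOn_negHess (hU : IsOpen U) (hh : ContDiffOn ℝ ∞ h U) :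
    ContDiffOn ℝ ∞ (negHess h) U := by
  have := contDiffOn_mixed hU hh
  exact ((this 1 1).mul (this 1 1)).sub ((this 2 0).mul (this 0 2))

theorem isOpen_hyperbolicSet (hU : IsOpen U) (hh : ContDiffOn ℝ ∞ h U) :
    IsOpen (hyperbolicSet h U) :=
  (contDiffOn_negHess hU hh).continuousOn.isOpen_inter_preimage hU isOpen_Ioi

theorem contDiffOn_quartic (hU : IsOpen U) (hh : ContDiffOn ℝ ∞ h U) :
    ContDiffOn ℝ ∞ (quartic h) (hyperbolicSet h U) :=
  ((contDiffOn_negHess hU hh).mono fun _ hx => hx.1).rpow_const_of_ne fun _ hx => hx.2.ne'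

theorem contDiffOn_normalScale (hU : IsOpen U) (hh : ContDiffOn ℝ ∞ h U) :
    ContDiffOn ℝ ∞ (normalScale h) (hyperbolicSet h U) :=
  (contDiffOn_quartic hU hh).div
    (contDiffOn_const.mul (((contDiffOn_negHess hU hh).mono fun _ hx => hx.1).pow 2))
    fun x hx => by have := hx.2.ne'; positivity

theorem contDiffOn_negHessU (hU : IsOpen U) (hh : ContDiffOn ℝ ∞ h U) :
    ContDiffOn ℝ ∞ (negHessU h) U := by
  have := contDiffOn_mixed hU hh
  exact ((contDiffOn_const.mul ((this 1 1).mul (this 2 1))).sub ((this 3 0).mul (this 0 2))).sub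
    ((this 2 0).mul (this 1 2))

theorem contDiffOn_negHessV (hU : IsOpen U) (hh : ContDiffOn ℝ ∞ h U) :
    ContDiffOn ℝ ∞ (negHessV h) U := by
  have := contDiffOn_mixed hU hh
  exact ((contDiffOn_const.mul ((this 1 1).mul (this 1 2))).sub ((this 2 1).mul (this 0 2))).sub
    ((this 2 0).mul (this 0 3))

theorem contDiffOn_normalU (hU : IsOpen U) (hh : ContDiffOn ℝ ∞ h U) :
    ContDiffOn ℝ ∞ (normalU h) (hyperbolicSet h U) :=
  (contDiffOn_normalScale hU hh).mul (ContDiffOn.mono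
    (((contDiffOn_negHessU hU hh).mul (contDiffOn_mixed hU hh 0 2)).sub
      ((contDiffOn_negHessV hU hh).mul (contDiffOn_mixed hU hh 1 1))) fun _ hx => hx.1)

theorem contDiffOn_numV (hU : IsOpen U) (hh : ContDiffOn ℝ ∞ h U) :
    ContDiffOn ℝ ∞ (numV h) U :=
  ((contDiffOn_negHessV hU hh).mul (contDiffOn_mixed hU hh 2 0)).sub
      ((contDiffOn_negHessU hU hh).mul (contDiffOn_mixed hU hh 1 1))

theorem contDiffOn_normalV (hU : IsOpen U) (hh : ContDiffOn ℝ ∞ h U) :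
    ContDiffOn ℝ ∞ (normalV h) (hyperbolicSet h U) :=
  (contDiffOn_normalScale hU hh).mul ((contDiffOn_numV hU hh).mono fun _ hx => hx.1)

theorem hasPartials_negHess (hU : IsOpen U) (hh : ContDiffOn ℝ ∞ h U) (hx : x ∈ U) :
    HasPartials (negHess h) (negHessU h x) (negHessV h x) x := by
  have hm := hasPartials_mixed hU hh hx
  refine (((hm 1 1).mul (hm 1 1)).sub ((hm 2 0).mul (hm 0 2))).congr ?_ ?_
  · simp only [negHessU]
    ring
  · simp only [negHessV]
    ring

theorem quartic_pos (hx : x ∈ hyperbolicSet h U) : 0 < quartic h x := Real.rpow_pos_of_pos hx.2 _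

theorem hasPartials_quartic (hU : IsOpen U) (hh : ContDiffOn ℝ ∞ h U)
    (hx : x ∈ hyperbolicSet h U) :
    HasPartials (quartic h) (quartic h x / (4 * negHess h x) * negHessU h x)
      (quartic h x / (4 * negHess h x) * negHessV h x) x := by
  have hd : HasDerivAt (fun y : ℝ => y ^ (1 / 4 : ℝ)) (quartic h x / (4 * negHess h x))
      (negHess h x) := by
    refine (Real.hasDerivAt_rpow_const (.inl hx.2.ne')).congr_deriv ?_
    rw [Real.rpow_sub_one hx.2.ne', quartic]
    have := hx.2.ne'
    field_simp
  exact HasPartials.comp hd (hasPartials_negHess hU hh hx.1)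

/-- This relation and the next one express that ξ_u and ξ_v are tangent to the surface: they cancel
the component of dξ along (0, 0, 1). -/
theorem normalU_mul_add (hx : x ∈ hyperbolicSet h U) :
    normalU h x * mixed h 2 0 x + normalV h x * mixed h 1 1 x =
      -(quartic h x / (4 * negHess h x) * negHessU h x) := by
  have := hx.2.ne'
  simp only [normalU, normalV, normalScale, numU, numV]
  field_simp
  simp only [negHess]
  ring

theorem normalV_mul_add (hx : x ∈ hyperbolicSet h U) :
    normalU h x * mixed h 1 1 x + normalV h x * mixed h 0 2 x =
      -(quartic h x / (4 * negHess h x) * negHessV h x) := by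
  have := hx.2.ne'
  simp only [normalU, normalV, normalScale, numU, numV]
  field_simp
  simp only [negHess]
  ring

theorem hasPartials_height (hU : IsOpen U) (hh : ContDiffOn ℝ ∞ h U) (hx : x ∈ U) :
    HasPartials h (mixed h 1 0 x) (mixed h 0 1 x) x := hasPartials_mixed hU hh hx 0 0

theorem pu_monge (hU : IsOpen U) (hh : ContDiffOn ℝ ∞ h U) (hx : x ∈ U) :
    pu (monge h) x = ![1, 0, mixed h 1 0 x] :=
  pu_vec3 .rfl (.fst x) (.snd x) (hasPartials_height hU hh hx)

theorem pv_monge (hU : IsOpen U) (hh : ContDiffOn ℝ ∞ h U) (hx : x ∈ U) :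
    pv (monge h) x = ![0, 1, mixed h 0 1 x] :=
  pv_vec3 .rfl (.fst x) (.snd x) (hasPartials_height hU hh hx)

theorem hessDet_monge (hU : IsOpen U) (hh : ContDiffOn ℝ ∞ h U) (hx : x ∈ U) :
    hessDet (monge h) x = -negHess h x := by
  have hm := hasPartials_mixed hU hh hx
  have hpu : pu (monge h) =ᶠ[𝓝 x] fun y => ![1, 0, mixed h 1 0 y] :=
    eventuallyEq_of_mem (hU.mem_nhds hx) fun y hy => pu_monge hU hh hy
  have hpv : pv (monge h) =ᶠ[𝓝 x] fun y => ![0, 1, mixed h 0 1 y] :=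
    eventuallyEq_of_mem (hU.mem_nhds hx) fun y hy => pv_monge hU hh hy
  simp only [hessDet, coefL, coefM, coefN, pu_monge hU hh hx, pv_monge hU hh hx,
    pu_vec3 hpu (.const 1 x) (.const 0 x) (hm 1 0), pv_vec3 hpu (.const 1 x) (.const 0 x) (hm 1 0),
    pv_vec3 hpv (.const 0 x) (.const 1 x) (hm 0 1), det3, Matrix.det_fin_three, negHess]
  simp
  ring

theorem coefL_monge (hU : IsOpen U) (hh : ContDiffOn ℝ ∞ h U) (hx : x ∈ U) :
    coefL (monge h) x = mixed h 2 0 x := by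
  have hpu : pu (monge h) =ᶠ[𝓝 x] fun y => ![1, 0, mixed h 1 0 y] :=
    eventuallyEq_of_mem (hU.mem_nhds hx) fun y hy => pu_monge hU hh hy
  simp only [coefL, pu_monge hU hh hx, pv_monge hU hh hx, det3, Matrix.det_fin_three,
    pu_vec3 hpu (.const 1 x) (.const 0 x) (hasPartials_mixed hU hh hx 1 0)]
  simp

theorem coefM_monge (hU : IsOpen U) (hh : ContDiffOn ℝ ∞ h U) (hx : x ∈ U) :
    coefM (monge h) x = mixed h 1 1 x := by
  have hpu : pu (monge h) =ᶠ[𝓝 x] fun y => ![1, 0, mixed h 1 0 y] :=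
    eventuallyEq_of_mem (hU.mem_nhds hx) fun y hy => pu_monge hU hh hy
  simp only [coefM, pu_monge hU hh hx, pv_monge hU hh hx, det3, Matrix.det_fin_three,
    pv_vec3 hpu (.const 1 x) (.const 0 x) (hasPartials_mixed hU hh hx 1 0)]
  simp

theorem coefN_monge (hU : IsOpen U) (hh : ContDiffOn ℝ ∞ h U) (hx : x ∈ U) :
    coefN (monge h) x = mixed h 0 2 x := by
  have hpv : pv (monge h) =ᶠ[𝓝 x] fun y => ![0, 1, mixed h 0 1 y] :=
    eventuallyEq_of_mem (hU.mem_nhds hx) fun y hy => pv_monge hU hh hy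
  simp only [coefN, pu_monge hU hh hx, pv_monge hU hh hx, det3, Matrix.det_fin_three,
    pv_vec3 hpv (.const 0 x) (.const 1 x) (hasPartials_mixed hU hh hx 0 1)]
  simp

theorem conormal_monge (hU : IsOpen U) (hh : ContDiffOn ℝ ∞ h U) (hx : x ∈ hyperbolicSet h U) :
    conormal (monge h) x = ![-((quartic h x)⁻¹ * mixed h 1 0 x),
      -((quartic h x)⁻¹ * mixed h 0 1 x), (quartic h x)⁻¹] := by
  rw [conormal, hessDet_monge hU hh hx.1, abs_neg, abs_of_pos hx.2, pu_monge hU hh hx.1,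
    pv_monge hU hh hx.1, ← quartic]
  ext i
  fin_cases i <;> simp [cross_apply]

theorem hasPartials_inv_quartic (hU : IsOpen U) (hh : ContDiffOn ℝ ∞ h U)
    (hx : x ∈ hyperbolicSet h U) :
    HasPartials (fun y => (quartic h y)⁻¹) (-((quartic h x)⁻¹ / (4 * negHess h x) * negHessU h x))
      (-((quartic h x)⁻¹ / (4 * negHess h x) * negHessV h x)) x := by
  have h0 := (quartic_pos hx).ne'
  have h1 := hx.2.ne'
  refine (HasPartials.comp (hasDerivAt_inv h0) (hasPartials_quartic hU hh hx)).congr ?_ ?_ <;>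
  field_simp

theorem pu_conormal_monge (hU : IsOpen U) (hh : ContDiffOn ℝ ∞ h U) (hx : x ∈ hyperbolicSet h U) :
    pu (conormal (monge h)) x = (quartic h x)⁻¹ • ![
      negHessU h x / (4 * negHess h x) * mixed h 1 0 x - mixed h 2 0 x,
      negHessU h x / (4 * negHess h x) * mixed h 0 1 x - mixed h 1 1 x,
      -(negHessU h x / (4 * negHess h x))] := by
  have hm := hasPartials_mixed hU hh hx.1
  have hq := hasPartials_inv_quartic hU hh hx
  have he : conormal (monge h) =ᶠ[𝓝 x] _ := eventuallyEq_of_mem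
    ((isOpen_hyperbolicSet hU hh).mem_nhds hx) fun y hy => conormal_monge hU hh hy
  rw [pu_vec3 he (hq.mul (hm 1 0)).neg (hq.mul (hm 0 1)).neg hq]
  ext i
  fin_cases i <;> simp <;> ring

theorem pv_conormal_monge (hU : IsOpen U) (hh : ContDiffOn ℝ ∞ h U) (hx : x ∈ hyperbolicSet h U) :
    pv (conormal (monge h)) x = (quartic h x)⁻¹ • ![
      negHessV h x / (4 * negHess h x) * mixed h 1 0 x - mixed h 1 1 x,
      negHessV h x / (4 * negHess h x) * mixed h 0 1 x - mixed h 0 2 x,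
      -(negHessV h x / (4 * negHess h x))] := by
  have hm := hasPartials_mixed hU hh hx.1
  have hq := hasPartials_inv_quartic hU hh hx
  have he : conormal (monge h) =ᶠ[𝓝 x] _ := eventuallyEq_of_mem
    ((isOpen_hyperbolicSet hU hh).mem_nhds hx) fun y hy => conormal_monge hU hh hy
  rw [pv_vec3 he (hq.mul (hm 1 0)).neg (hq.mul (hm 0 1)).neg hq]
  ext i
  fin_cases i <;> simp <;> ring

theorem affineNormal_monge (hU : IsOpen U) (hh : ContDiffOn ℝ ∞ h U)
    (hx : x ∈ hyperbolicSet h U) :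
    affineNormal (monge h) x = ![normalU h x, normalV h x,
      normalU h x * mixed h 1 0 x + normalV h x * mixed h 0 1 x + quartic h x] := by
  have h0 := (quartic_pos hx).ne'
  have h1 := hx.2.ne'
  have hdet : det3 (conormal (monge h) x) (pu (conormal (monge h)) x)
      (pv (conormal (monge h)) x) = -((quartic h x)⁻¹ ^ 3 * negHess h x) := by
    rw [conormal_monge hU hh hx, pu_conormal_monge hU hh hx, pv_conormal_monge hU hh hx, det3,
      Matrix.det_fin_three]
    simp
    field_simp
    simp only [negHess]
    ring
  rw [affineNormal, hdet, pu_conormal_monge hU hh hx, pv_conormal_monge hU hh hx]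
  ext i
  fin_cases i
  · simp [cross_apply, normalU, normalScale, numU]
    field_simp
    ring
  · simp [cross_apply, normalV, normalScale, numV]
    field_simp
    ring
  · simp [cross_apply, normalU, normalV, normalScale, numU, numV]
    field_simp
    simp only [negHess]
    ring

theorem fderiv_affineNormal_monge (hU : IsOpen U) (hh : ContDiffOn ℝ ∞ h U)
    (hx : x ∈ hyperbolicSet h U) (w : ℝ × ℝ) :
    fderiv ℝ (affineNormal (monge h)) x w =
      (pu (normalU h) x * w.1 + pv (normalU h) x * w.2) • ![1, 0, mixed h 1 0 x] +
      (pu (normalV h) x * w.1 + pv (normalV h) x * w.2) • ![0, 1, mixed h 0 1 x] := by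
  have hN := isOpen_hyperbolicSet hU hh
  have hm := hasPartials_mixed hU hh hx.1
  have hq := hasPartials_quartic hU hh hx
  have hu := hasPartials_of_contDiffOn hN (contDiffOn_normalU hU hh) hx
  have hv := hasPartials_of_contDiffOn hN (contDiffOn_normalV hU hh) hx
  have he : affineNormal (monge h) =ᶠ[𝓝 x] _ := eventuallyEq_of_mem
    (hN.mem_nhds hx) fun y hy => affineNormal_monge hU hh hy
  rw [fderiv_vec3 he hu hv (((hu.mul (hm 1 0)).add (hv.mul (hm 0 1))).add hq)]
  ext i
  fin_cases i
  · simp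
  · simp
  · simp
    linear_combination w.1 * normalU_mul_add hx + w.2 * normalV_mul_add hx

theorem fderiv_monge (hU : IsOpen U) (hh : ContDiffOn ℝ ∞ h U) (hx : x ∈ U) (w : ℝ × ℝ) :
    fderiv ℝ (monge h) x w = w.1 • ![1, 0, mixed h 1 0 x] + w.2 • ![0, 1, mixed h 0 1 x] := by
  have he : monge h =ᶠ[𝓝 x] fun y => ![y.1, y.2, h y] := .rfl
  rw [fderiv_vec3 he (.fst x) (.snd x) (hasPartials_height hU hh hx)]
  ext i
  fin_cases i <;> simp
  ring

variable (h) in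
/-- Coefficients of the equation `dξ ∧ dX = 0` of the affine curvature lines. -/
def lineA (x : ℝ × ℝ) : ℝ := -pu (normalV h) x

variable (h) in
def lineB (x : ℝ × ℝ) : ℝ := pu (normalU h) x - pv (normalV h) x

variable (h) in
def lineC (x : ℝ × ℝ) : ℝ := pv (normalU h) x

theorem fderiv_affineNormal_eq_iff (hU : IsOpen U) (hh : ContDiffOn ℝ ∞ h U)
    (hx : x ∈ hyperbolicSet h U) (w : ℝ × ℝ) (μ : ℝ) :
    fderiv ℝ (affineNormal (monge h)) x w = μ • fderiv ℝ (monge h) x w ↔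
      pu (normalU h) x * w.1 + pv (normalU h) x * w.2 = μ * w.1 ∧
      pu (normalV h) x * w.1 + pv (normalV h) x * w.2 = μ * w.2 := by
  rw [fderiv_affineNormal_monge hU hh hx, fderiv_monge hU hh hx.1]
  constructor
  · intro H
    have h0 := congrFun H 0
    have h1 := congrFun H 1
    simp at h0 h1
    exact ⟨h0, h1⟩
  · rintro ⟨h0, h1⟩
    rw [h0, h1, smul_add, smul_smul, smul_smul]

theorem isPrincipal_monge_iff (hU : IsOpen U) (hh : ContDiffOn ℝ ∞ h U)
    (hx : x ∈ hyperbolicSet h U) (w : ℝ × ℝ) :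
    IsPrincipal (monge h) x w ↔
      lineA h x * w.1 ^ 2 + lineB h x * w.1 * w.2 + lineC h x * w.2 ^ 2 = 0 := by
  simp only [IsPrincipal, fderiv_affineNormal_eq_iff hU hh hx, lineA, lineB, lineC]
  constructor
  · rintro ⟨μ, h0, h1⟩
    linear_combination w.2 * h0 - w.1 * h1
  · intro H
    by_cases h1 : w.1 = 0
    · by_cases h2 : w.2 = 0
      · exact ⟨0, by simp [h1, h2]⟩
      · refine ⟨pv (normalV h) x, ?_, by rw [h1]; ring⟩
        have : pv (normalU h) x * w.2 ^ 2 = 0 := by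
          rw [h1] at H
          linear_combination H
        have h3 : pv (normalU h) x = 0 := (mul_eq_zero.1 this).resolve_right (pow_ne_zero 2 h2)
        rw [h1, h3]
        ring
    · refine ⟨pu (normalU h) x + pv (normalU h) x * w.2 / w.1, by field_simp, ?_⟩
      field_simp
      linear_combination -H

theorem isUmbilic_monge_iff (hU : IsOpen U) (hh : ContDiffOn ℝ ∞ h U)
    (hx : x ∈ hyperbolicSet h U) :
    IsUmbilic (monge h) x ↔ lineA h x = 0 ∧ lineB h x = 0 ∧ lineC h x = 0 := by
  simp only [IsUmbilic, fderiv_affineNormal_eq_iff hU hh hx, lineA, lineB, lineC]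
  constructor
  · rintro ⟨μ, H⟩
    have h1 := H (1, 0)
    have h2 := H (0, 1)
    simp only [mul_one, mul_zero, add_zero, zero_add] at h1 h2
    exact ⟨by rw [h1.2, neg_zero], by rw [h1.1, h2.2, sub_self], h2.1⟩
  · rintro ⟨h1, h2, h3⟩
    refine ⟨pu (normalU h) x, fun w => ⟨?_, ?_⟩⟩
    · rw [h3]
      ring
    · linear_combination (-w.1) * h1 - w.2 * h2

theorem mem_disc_affineConfiguration_iff (hU : IsOpen U) (hh : ContDiffOn ℝ ∞ h U)
    (hx : x ∈ hyperbolicSet h U) :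
    x ∈ (affineConfiguration (monge h) U).disc ↔
      lineB h x ^ 2 - 4 * lineA h x * lineC h x = 0 := by
  have h0 : hessDet (monge h) x ≠ 0 := by
    rw [hessDet_monge hU hh hx.1]
    exact neg_ne_zero.2 hx.2.ne'
  rw [← discriminant_eq_zero_iff, ← isUmbilic_monge_iff hU hh hx]
  simp only [affineConfiguration, mem_ofPred_eq, hx.1, h0, ne_eq, not_false_eq_true, true_and,
    IsDoubleDirectionAt, isPrincipal_monge_iff hU hh hx]

/-- Self-adjointness of the shape operator for the affine metric. It is ρ_uv = ρ_vu, written through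
Hessian · (a, b) = −∇ρ; the terms with third derivatives of h cancel. -/
theorem affineNormal_symm (hU : IsOpen U) (hh : ContDiffOn ℝ ∞ h U)
    (hx : x ∈ hyperbolicSet h U) :
    mixed h 2 0 x * pv (normalU h) x + mixed h 1 1 x * pv (normalV h) x =
      mixed h 1 1 x * pu (normalU h) x + mixed h 0 2 x * pu (normalV h) x := by
  have hN := isOpen_hyperbolicSet hU hh
  have hm := hasPartials_mixed hU hh hx.1
  have hu := hasPartials_of_contDiffOn hN (contDiffOn_normalU hU hh) hx
  have hv := hasPartials_of_contDiffOn hN (contDiffOn_normalV hU hh) hx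
  have hqs := contDiffOn_quartic hU hh
  have e1 : EqOn (fun y => normalU h y * mixed h 2 0 y + normalV h y * mixed h 1 1 y)
      (fun y => -pu (quartic h) y) (hyperbolicSet h U) := fun y hy =>
    (normalU_mul_add hy).trans (congrArg Neg.neg (hasPartials_quartic hU hh hy).pu_eq.symm)
  have e2 : EqOn (fun y => normalU h y * mixed h 1 1 y + normalV h y * mixed h 0 2 y)
      (fun y => -pv (quartic h) y) (hyperbolicSet h U) := fun y hy =>
    (normalV_mul_add hy).trans (congrArg Neg.neg (hasPartials_quartic hU hh hy).pv_eq.symm)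
  have f1 := pv_congr hN hx e1
  have f2 := pu_congr hN hx e2
  rw [((hu.mul (hm 2 0)).add (hv.mul (hm 1 1))).pv_eq,
    (hasPartials_of_contDiffOn hN (contDiffOn_pu hN hqs) hx).neg.pv_eq] at f1
  rw [((hu.mul (hm 1 1)).add (hv.mul (hm 0 2))).pu_eq,
    (hasPartials_of_contDiffOn hN (contDiffOn_pv hN hqs) hx).neg.pu_eq,
    ← pv_pu_comm hN hqs hx] at f2
  linear_combination f1 - f2

/-- Pairing ν_u, ν_v with X_u, X_v gives −Hessian/ρ, so l, m, n are the entries of −Hessian · B/ρ.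
Combining them with L, M, N leaves the factor δ/ρ, where δ = −det Hessian; the first two
coefficients need self-adjointness. -/
theorem affineBDE_monge (hU : IsOpen U) (hh : ContDiffOn ℝ ∞ h U) (hx : x ∈ hyperbolicSet h U) :
    ∃ κ : ℝ, κ ≠ 0 ∧ (affineBDE (monge h)).a x = κ * lineA h x ∧
      (affineBDE (monge h)).b x = κ * lineB h x ∧ (affineBDE (monge h)).c x = κ * lineC h x := by
  have hsym := affineNormal_symm hU hh hx
  have hpu : pu (affineNormal (monge h)) x = _ := fderiv_affineNormal_monge hU hh hx (1, 0)
  have hpv : pv (affineNormal (monge h)) x = _ := fderiv_affineNormal_monge hU hh hx (0, 1)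
  simp only [mul_one, mul_zero, add_zero, zero_add] at hpu hpv
  have hl : third_l (monge h) x = -(quartic h x)⁻¹ *
      (mixed h 2 0 x * pu (normalU h) x + mixed h 1 1 x * pu (normalV h) x) := by
    rw [third_l, pu_conormal_monge hU hh hx, hpu]
    simp
    ring
  have hm : third_m (monge h) x = -(quartic h x)⁻¹ *
      (mixed h 2 0 x * pv (normalU h) x + mixed h 1 1 x * pv (normalV h) x) := by
    rw [third_m, pu_conormal_monge hU hh hx, hpv]
    simp
    ring
  have hn : third_n (monge h) x = -(quartic h x)⁻¹ *
      (mixed h 1 1 x * pv (normalU h) x + mixed h 0 2 x * pv (normalV h) x) := by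
    rw [third_n, pv_conormal_monge hU hh hx, hpv]
    simp
    ring
  refine ⟨(quartic h x)⁻¹ * negHess h x,
    mul_ne_zero (inv_ne_zero (quartic_pos hx).ne') hx.2.ne', ?_, ?_, ?_⟩
  · simp only [affineBDE, hl, hm, coefL_monge hU hh hx.1, coefM_monge hU hh hx.1, lineA, negHess]
    linear_combination (quartic h x)⁻¹ * mixed h 2 0 x * hsym
  · simp only [affineBDE, hl, hn, coefL_monge hU hh hx.1, coefN_monge hU hh hx.1, lineB, negHess]
    linear_combination (quartic h x)⁻¹ * mixed h 1 1 x * hsym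
  · simp only [affineBDE, hm, hn, coefM_monge hU hh hx.1, coefN_monge hU hh hx.1, lineC, negHess]
    ring

end Monge

/-! ### The jet of the affine curvature lines at the origin -/

section Jet

variable (h : ℝ × ℝ → ℝ)

def negHessUU (x : ℝ × ℝ) : ℝ :=
  2 * (mixed h 2 1 x * mixed h 2 1 x + mixed h 1 1 x * mixed h 3 1 x)
    - (mixed h 4 0 x * mixed h 0 2 x + mixed h 3 0 x * mixed h 1 2 x)
    - (mixed h 3 0 x * mixed h 1 2 x + mixed h 2 0 x * mixed h 2 2 x)

def negHessUV (x : ℝ × ℝ) : ℝ :=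
  2 * (mixed h 1 2 x * mixed h 2 1 x + mixed h 1 1 x * mixed h 2 2 x)
    - (mixed h 3 1 x * mixed h 0 2 x + mixed h 3 0 x * mixed h 0 3 x)
    - (mixed h 2 1 x * mixed h 1 2 x + mixed h 2 0 x * mixed h 1 3 x)

def negHessVV (x : ℝ × ℝ) : ℝ :=
  2 * (mixed h 1 2 x * mixed h 1 2 x + mixed h 1 1 x * mixed h 1 3 x)
    - (mixed h 2 2 x * mixed h 0 2 x + mixed h 2 1 x * mixed h 0 3 x)
    - (mixed h 2 1 x * mixed h 0 3 x + mixed h 2 0 x * mixed h 0 4 x)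

/-- The `u`-derivative of `numV`. -/
def numVU (x : ℝ × ℝ) : ℝ :=
  negHessUV h x * mixed h 2 0 x + negHessV h x * mixed h 3 0 x
    - (negHessUU h x * mixed h 1 1 x + negHessU h x * mixed h 2 1 x)

variable {h} {U : Set (ℝ × ℝ)} {x : ℝ × ℝ}

theorem hasPartials_negHessU (hU : IsOpen U) (hh : ContDiffOn ℝ ∞ h U) (hx : x ∈ U) :
    HasPartials (negHessU h) (negHessUU h x) (negHessUV h x) x := by
  have hm := hasPartials_mixed hU hh hx
  refine ((((HasPartials.const 2 x).mul ((hm 1 1).mul (hm 2 1))).sub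
    ((hm 3 0).mul (hm 0 2))).sub ((hm 2 0).mul (hm 1 2))).congr ?_ ?_
  · simp only [negHessUU]
    ring
  · simp only [negHessUV]
    ring

theorem hasPartials_negHessV (hU : IsOpen U) (hh : ContDiffOn ℝ ∞ h U) (hx : x ∈ U) :
    HasPartials (negHessV h) (negHessUV h x) (negHessVV h x) x := by
  have hm := hasPartials_mixed hU hh hx
  refine ((((HasPartials.const 2 x).mul ((hm 1 1).mul (hm 1 2))).sub
    ((hm 2 1).mul (hm 0 2))).sub ((hm 2 0).mul (hm 0 3))).congr ?_ ?_
  · simp only [negHessUV]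
    ring
  · simp only [negHessVV]
    ring

theorem hasPartials_numU (hU : IsOpen U) (hh : ContDiffOn ℝ ∞ h U) (hx : x ∈ U) :
    HasPartials (numU h)
      (negHessUU h x * mixed h 0 2 x + negHessU h x * mixed h 1 2 x
        - (negHessUV h x * mixed h 1 1 x + negHessV h x * mixed h 2 1 x))
      (negHessUV h x * mixed h 0 2 x + negHessU h x * mixed h 0 3 x
        - (negHessVV h x * mixed h 1 1 x + negHessV h x * mixed h 1 2 x)) x := by
  have hm := hasPartials_mixed hU hh hx
  exact ((hasPartials_negHessU hU hh hx).mul (hm 0 2)).sub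
    ((hasPartials_negHessV hU hh hx).mul (hm 1 1))

theorem hasPartials_numV (hU : IsOpen U) (hh : ContDiffOn ℝ ∞ h U) (hx : x ∈ U) :
    HasPartials (numV h) (numVU h x)
      (negHessVV h x * mixed h 2 0 x + negHessV h x * mixed h 2 1 x
        - (negHessUV h x * mixed h 1 1 x + negHessU h x * mixed h 1 2 x)) x := by
  have hm := hasPartials_mixed hU hh hx
  exact ((hasPartials_negHessV hU hh hx).mul (hm 2 0)).sub
    ((hasPartials_negHessU hU hh hx).mul (hm 1 1))

theorem IsHyperbolicNormalForm.mixed_eq (hnf : IsHyperbolicNormalForm h) :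
    mixed h 2 0 (0, 0) = 0 ∧ mixed h 1 1 (0, 0) = 1 ∧ mixed h 0 2 (0, 0) = 0 ∧
      mixed h 2 1 (0, 0) = 0 ∧ mixed h 1 2 (0, 0) = 0 :=
  hnf.2.2.2

theorem zero_mem_hyperbolicSet (h0 : (0, 0) ∈ U) (hnf : IsHyperbolicNormalForm h) :
    (0, 0) ∈ hyperbolicSet h U := by
  obtain ⟨h20, h11, h02, -, -⟩ := hnf.mixed_eq
  exact ⟨h0, by simp [negHess, h20, h11]⟩

theorem normalScale_zero (hnf : IsHyperbolicNormalForm h) : normalScale h (0, 0) = 1 / 4 := by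
  obtain ⟨h20, h11, h02, -, -⟩ := hnf.mixed_eq
  simp [normalScale, quartic, negHess, h20, h11]

/-- Since δ_u = δ_v = 0 at the origin, `numU` and `numV` vanish there, and only the value 1/4 of the
scale enters, not its derivatives. -/
theorem normal_jet (hU : IsOpen U) (h0 : (0, 0) ∈ U) (hh : ContDiffOn ℝ ∞ h U)
    (hnf : IsHyperbolicNormalForm h) :
    lineA h (0, 0) = q h 3 1 / 2 ∧ lineB h (0, 0) = 0 ∧ lineC h (0, 0) = -q h 1 3 / 2 := by
  obtain ⟨h20, h11, h02, h21, h12⟩ := hnf.mixed_eq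
  have hs := hasPartials_of_contDiffOn (isOpen_hyperbolicSet hU hh)
    (contDiffOn_normalScale hU hh) (zero_mem_hyperbolicSet h0 hnf)
  have hu : HasPartials (normalU h) _ _ (0, 0) := hs.mul (hasPartials_numU hU hh h0)
  have hv : HasPartials (normalV h) _ _ (0, 0) := hs.mul (hasPartials_numV hU hh h0)
  have hq : ∀ i j, mixed h i j (0, 0) = q h i j := fun _ _ => rfl
  simp only [lineA, lineB, lineC, hu.pu_eq, hu.pv_eq, hv.pu_eq, hv.pv_eq, normalScale_zero hnf,
    numU, numV, numVU, negHessU, negHessV, negHessUU, negHessUV, negHessVV, h20, h11, h02, h21,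
    h12, hq]
  refine ⟨by ring, by ring, by ring⟩

/-- At the origin `numV` vanishes and its u-derivative is −2 q₃₁ = 0, so all derivatives of the
scale drop out and the result is −1/4 times the second u-derivative of `numV`. -/
theorem pu_lineA_zero (hU : IsOpen U) (h0 : (0, 0) ∈ U) (hh : ContDiffOn ℝ ∞ h U)
    (hnf : IsHyperbolicNormalForm h) (h31 : q h 3 1 = 0) :
    pu (lineA h) (0, 0) =
      (2 * q h 0 3 * q h 3 0 ^ 2 - 7 * q h 2 2 * q h 3 0 + 2 * q h 4 1) / 4 := by
  obtain ⟨h20, h11, h02, h21, h12⟩ := hnf.mixed_eq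
  have hN := isOpen_hyperbolicSet hU hh
  have h0N := zero_mem_hyperbolicSet h0 hnf
  have hss := contDiffOn_normalScale hU hh
  have hm := hasPartials_mixed hU hh h0
  have hs := hasPartials_of_contDiffOn hN hss h0N
  have hsu := hasPartials_of_contDiffOn hN (contDiffOn_pu hN hss) h0N
  have hUU : HasPartials (negHessUU h) _ _ (0, 0) :=
    ((HasPartials.const 2 _).mul (((hm 2 1).mul (hm 2 1)).add ((hm 1 1).mul (hm 3 1)))).sub
      (((hm 4 0).mul (hm 0 2)).add ((hm 3 0).mul (hm 1 2))) |>.sub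
      (((hm 3 0).mul (hm 1 2)).add ((hm 2 0).mul (hm 2 2)))
  have hUV : HasPartials (negHessUV h) _ _ (0, 0) :=
    ((HasPartials.const 2 _).mul (((hm 1 2).mul (hm 2 1)).add ((hm 1 1).mul (hm 2 2)))).sub
      (((hm 3 1).mul (hm 0 2)).add ((hm 3 0).mul (hm 0 3))) |>.sub
      (((hm 2 1).mul (hm 1 2)).add ((hm 2 0).mul (hm 1 3)))
  have hVU : HasPartials (numVU h) _ _ (0, 0) :=
    ((hUV.mul (hm 2 0)).add ((hasPartials_negHessV hU hh h0).mul (hm 3 0))).sub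
      ((hUU.mul (hm 1 1)).add ((hasPartials_negHessU hU hh h0).mul (hm 2 1)))
  have hA : EqOn (lineA h)
      (fun y => -(pu (normalScale h) y * numV h y + normalScale h y * numVU h y))
      (hyperbolicSet h U) := fun y hy => by
    have hv : HasPartials (normalV h) _ _ y :=
      (hasPartials_of_contDiffOn hN hss hy).mul (hasPartials_numV hU hh hy.1)
    simp only [lineA, hv.pu_eq]
  rw [pu_congr hN h0N hA,
    ((hsu.mul (hasPartials_numV hU hh h0)).add (hs.mul hVU)).neg.pu_eq]
  have hq : ∀ i j, mixed h i j (0, 0) = q h i j := fun _ _ => rfl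
  simp only [normalScale_zero hnf, numV, numVU, negHessU, negHessV, negHessUU, negHessUV, h20,
    h11, h02, h21, h12, hq, h31]
  ring

theorem contDiffOn_line (hU : IsOpen U) (hh : ContDiffOn ℝ ∞ h U) :
    ContDiffOn ℝ ∞ (lineA h) (hyperbolicSet h U) ∧ ContDiffOn ℝ ∞ (lineB h) (hyperbolicSet h U) ∧
      ContDiffOn ℝ ∞ (lineC h) (hyperbolicSet h U) := by
  have hN := isOpen_hyperbolicSet hU hh
  have hu := contDiffOn_normalU hU hh
  have hv := contDiffOn_normalV hU hh
  exact ⟨(contDiffOn_pu hN hv).neg, (contDiffOn_pu hN hu).sub (contDiffOn_pv hN hv),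
    contDiffOn_pv hN hu⟩

theorem isDoubleDirectionAt_monge (hU : IsOpen U) (h0 : (0, 0) ∈ U) (hh : ContDiffOn ℝ ∞ h U)
    (hnf : IsHyperbolicNormalForm h) (h31 : q h 3 1 = 0) (h13 : q h 1 3 ≠ 0) :
    IsDoubleDirectionAt (monge h) (0, 0) (1, 0) := by
  obtain ⟨hA, hB, hC⟩ := normal_jet hU h0 hh hnf
  refine ⟨by simp, fun w => ?_⟩
  rw [isPrincipal_monge_iff hU hh (zero_mem_hyperbolicSet h0 hnf), hA, hB, hC, h31]
  constructor
  · intro H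
    have h1 : q h 1 3 * w.2 ^ 2 = 0 := by linear_combination (-2) * H
    have h2 : w.2 = 0 := by simpa [h13] using h1
    exact ⟨w.1, by ext <;> simp [h2]⟩
  · rintro ⟨c, rfl⟩
    simp

/-- Both configurations come from the same quadratic form; the nonzero factor κ of (*) changes
neither its roots nor the zero set of the discriminant, which is multiplied by κ². -/
theorem isCuspType_affineConfiguration (hU : IsOpen U) (h0 : (0, 0) ∈ U)
    (hh : ContDiffOn ℝ ∞ h U) (hnf : IsHyperbolicNormalForm h) (h31 : q h 3 1 = 0)
    (h13 : q h 1 3 ≠ 0)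
    (h41 : 2 * q h 0 3 * q h 3 0 ^ 2 - 7 * q h 2 2 * q h 3 0 + 2 * q h 4 1 ≠ 0) :
    (affineConfiguration (monge h) U).IsCuspType ∧
      ((affineBDE (monge h)).configuration U).IsCuspType := by
  obtain ⟨hA, hB, hC⟩ := normal_jet hU h0 hh hnf
  obtain ⟨sA, sB, sC⟩ := contDiffOn_line hU hh
  have hN := isOpen_hyperbolicSet hU hh
  have h0N := zero_mem_hyperbolicSet h0 hnf
  have hA0 : lineA h (0, 0) = 0 := by rw [hA, h31, zero_div]
  have hC0 : lineC h (0, 0) ≠ 0 := by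
    rw [hC]
    exact div_ne_zero (neg_ne_zero.2 h13) two_ne_zero
  have hAu : fderiv ℝ (lineA h) (0, 0) (1, 0) ≠ 0 := by
    have := pu_lineA_zero hU h0 hh hnf h31
    rw [pu] at this
    rw [this]
    exact div_ne_zero h41 (by norm_num)
  refine ⟨Configuration.isCuspType_of_quadratic hN h0N (fun x hx => ⟨hx.1, ?_⟩) sA sB sC hA0 hB
      hC0 hAu (fun x hx => isPrincipal_monge_iff hU hh hx)
      (fun x hx => mem_disc_affineConfiguration_iff hU hh hx)
      fun x hx hs => ((isUmbilic_monge_iff hU hh hx).1 hs.2.2).2.2,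
    Configuration.isCuspType_of_quadratic hN h0N (fun x hx => hx.1) sA sB sC hA0 hB
      hC0 hAu (fun x hx w => ?_) (fun x hx => ?_) fun x hx hs => ?_⟩
  · rw [hessDet_monge hU hh hx.1]
    exact neg_ne_zero.2 hx.2.ne'
  · obtain ⟨κ, hκ, ha, hb, hc⟩ := affineBDE_monge hU hh hx
    simp only [BDE.configuration, ha, hb, hc]
    rw [show κ * lineA h x * w.1 ^ 2 + κ * lineB h x * w.1 * w.2 + κ * lineC h x * w.2 ^ 2 =
      κ * (lineA h x * w.1 ^ 2 + lineB h x * w.1 * w.2 + lineC h x * w.2 ^ 2) by ring,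
      mul_eq_zero, or_iff_right hκ]
  · obtain ⟨κ, hκ, ha, hb, hc⟩ := affineBDE_monge hU hh hx
    simp only [BDE.configuration, ha, hb, hc, mem_ofPred_eq, hx.1, true_and]
    rw [show (κ * lineB h x) ^ 2 - 4 * (κ * lineA h x) * (κ * lineC h x) =
      κ ^ 2 * (lineB h x ^ 2 - 4 * lineA h x * lineC h x) by ring,
      mul_eq_zero, or_iff_right (pow_ne_zero 2 hκ)]
  · obtain ⟨κ, hκ, ha, hb, hc⟩ := affineBDE_monge hU hh hx
    have h1 := hs.2.2.2
    rw [hc] at h1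
    exact (mul_eq_zero.1 h1).resolve_left hκ

end Jet

end AffineLines

end

theorem mainTheorem7 (h : ℝ × ℝ → ℝ) (U : Set (ℝ × ℝ)) (hU : IsOpen U)
    (h0 : ((0, 0) : ℝ × ℝ) ∈ U) (hsmooth : ContDiffOn ℝ ∞ h U)
    (hnf : AffineLines.IsHyperbolicNormalForm h)
    (h31 : AffineLines.q h 3 1 = 0)
    (hne : AffineLines.q h 1 3 *
      (2 * AffineLines.q h 0 3 * AffineLines.q h 3 0 ^ 2
        - 7 * AffineLines.q h 2 2 * AffineLines.q h 3 0
        + 2 * AffineLines.q h 4 1) ≠ 0) :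
    AffineLines.IsDoubleDirectionAt (AffineLines.monge h) (0, 0) (1, 0) ∧
    (AffineLines.affineConfiguration (AffineLines.monge h) U).LocallyTopEquiv (0, 0)
      (AffineLines.cuspBDE.configuration Set.univ) (0, 0) ∧
    ((AffineLines.affineBDE (AffineLines.monge h)).configuration U).LocallyTopEquiv (0, 0)
      (AffineLines.cuspBDE.configuration Set.univ) (0, 0) ∧
    (AffineLines.affineConfiguration (AffineLines.monge h) U).CuspsAlongDiscriminant (0, 0) ∧
    ((AffineLines.affineBDE (AffineLines.monge h)).configuration U).CuspsAlongDiscriminant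
      (0, 0) := by
  obtain ⟨h13, h41⟩ := mul_ne_zero_iff.1 hne
  obtain ⟨hK, hE⟩ := AffineLines.isCuspType_affineConfiguration hU h0 hsmooth hnf h31 h13 h41
  exact ⟨AffineLines.isDoubleDirectionAt_monge hU h0 hsmooth hnf h31 h13,
    hK.locallyTopEquiv AffineLines.isCuspType_cuspBDE,
    hE.locallyTopEquiv AffineLines.isCuspType_cuspBDE,
    hK.cuspsAlongDiscriminant, hE.cuspsAlongDiscriminant⟩
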